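/- **Chow's strong law of large numbers in Riesz spaces.** Let $E$ be a Dedekind complete Riesz space with weak order unit $e$, and let $E^u$ be its universal completion, in which real powers of positive elements are formed by functional calculus with respect to $e$. Here a *conditional expectation* on $E$ is a positive order continuous linear projection on $E$ which maps weak order units to weak order units and whose range is a Dedekind complete Riesz subspace of $E$. Let $T$ be a conditional expectation on $E$ with $Te=e$ which is strictly positive ($T|f|=0$ implies $f=0$) and acts on its natural domain, $E=L^1(T)$; that is, $E=\mathrm{dom}(T)-\mathrm{dom}(T)$, where $\mathrm{dom}(T)$ is the set of those $f\in E^u_+$ which are the supremum of an upwards directed net $(f_\alpha)$ in $E_+$ with $(Tf_\alpha)$ order bounded in $E^u$. For $1\le p<\infty$ put $L^p(T)=\{x\in L^1(T): |x|^p\in L^1(T)\}$. Let $1\le p\le 2$ and let $(Y_n,T_n)_{n\ge 1}$ be a martingale difference sequence in $L^p(T)$ compatible with $T$: the $T_n$ are conditional expectations on $L^1(T)$ with $T_iT_j=T_jT_i=T_i$ for $i<j$ and $TT_n=T=T_nT$ for all $n$; $Y_n\in L^p(T)$ and $Y_n\in R(T_n)$, the range of $T_n$, for all $n\ge 1$;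 and $T_{n-1}Y_n=0$ for $n\ge 2$. Let $(a_i)_{i\ge1}$ be a non-decreasing sequence of positive real numbers divergent to $+\infty$ such that the series $$\sum_{i=1}^\infty T_1\left(\frac{|Y_i|^p}{a_i^p}\right)$$ is order convergent in $L^1(T)$. Then $$\frac1{a_n}\sum_{i=1}^n Y_i\to 0\quad\text{in order in } L^1(T)\text{ as } n\to\infty .$$ -/

import Mathlib

namespace RieszSpace

/-! A Dedekind complete Riesz space is encoded by the Mathlib classes
`[ConditionallyCompleteLattice E] [AddCommGroup E] [IsOrderedAddMonoid E] [Module ℝ E]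
[IsOrderedModule ℝ E]`. -/

section Basic

variable {E : Type*} [Lattice E] [AddCommGroup E]

/-- Order convergence of a sequence: `|x n - l| ≤ v n` for some `v n ↓ 0`. -/
def OrderTendsto (x : ℕ → E) (l : E) : Prop :=
  ∃ v : ℕ → E, Antitone v ∧ IsGLB (Set.range v) 0 ∧ ∀ n, |x n - l| ≤ v n

/-- The series `∑ x i` is order convergent: its partial sums converge in order. -/
def OrderSummable (x : ℕ → E) : Prop :=
  ∃ s : E, OrderTendsto (fun n => ∑ i ∈ Finset.range n, x i) s

/-- `e` is a weak order unit: `e ≥ 0`, and only `0` is disjoint from `e`. -/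
def IsWeakOrderUnit (e : E) : Prop :=
  0 ≤ e ∧ ∀ x : E, e ⊓ |x| = 0 → x = 0

variable [Module ℝ E]

/-- A conditional expectation operator: a positive order continuous linear projection which maps
weak order units to weak order units and whose range is a Dedekind complete Riesz subspace. -/
structure IsConditionalExpectation (T : E →ₗ[ℝ] E) : Prop where
  positive : ∀ x, 0 ≤ x → 0 ≤ T x
  orderContinuous : ∀ D : Set E, D.Nonempty → DirectedOn (· ≥ ·) D → IsGLB D 0 →
    IsGLB (T '' D) 0
  projection : ∀ x, T (T x) = T x
  map_weakOrderUnit : ∀ w, IsWeakOrderUnit w → IsWeakOrderUnit (T w)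
  sup_mem_range : ∀ x ∈ Set.range T, ∀ y ∈ Set.range T, x ⊔ y ∈ Set.range T
  /-- The supremum here is the one computed within the range. -/
  range_dedekindComplete : ∀ S ⊆ Set.range T, S.Nonempty →
    (∃ b ∈ Set.range T, b ∈ upperBounds S) →
    ∃ s ∈ Set.range T, s ∈ upperBounds S ∧ ∀ b ∈ Set.range T, b ∈ upperBounds S → s ≤ b

/-- `T` is strictly positive: `T |x| = 0` only for `x = 0`. -/
def IsStrictlyPositive (T : E →ₗ[ℝ] E) : Prop :=
  ∀ x, T |x| = 0 → x = 0

/-- A filtration: conditional expectations with `F i F j = F j F i = F i` for `i < j`. -/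
structure IsFiltration (F : ℕ → E →ₗ[ℝ] E) : Prop where
  condExp : ∀ i, IsConditionalExpectation (F i)
  comp_of_lt : ∀ i j, i < j → F i ∘ₗ F j = F i ∧ F j ∘ₗ F i = F i

/-- The filtration `F` is compatible with `T`. -/
def IsCompatible (T : E →ₗ[ℝ] E) (F : ℕ → E →ₗ[ℝ] E) : Prop :=
  ∀ i, T ∘ₗ F i = T ∧ F i ∘ₗ T = T

/-- `(Y, F)` is a martingale difference sequence. Indices start at `0`, so `F 0` is the first
operator of the filtration. -/
structure IsMartingaleDifference (Y : ℕ → E) (F : ℕ → E →ₗ[ℝ] E) : Prop where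
  filtration : IsFiltration F
  adapted : ∀ i, Y i ∈ Set.range (F i)
  condExp_succ : ∀ i, F i (Y (i + 1)) = 0

end Basic

section UniversalCompletion

variable {E U : Type*} [Lattice E] [AddCommGroup E] [Module ℝ E]
  [ConditionallyCompleteLattice U] [AddCommGroup U] [Module ℝ U]

/-- `ι : E → U` exhibits the Dedekind complete Riesz space `U` as the universal completion `E^u`
of `E`: `U` is also laterally complete (so universally complete), and `ι` is an injective Riesz
homomorphism with order dense range. -/
structure IsUniversalCompletion (ι : E →ₗ[ℝ] U) : Prop where
  injective : Function.Injective ι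
  map_sup : ∀ x y, ι (x ⊔ y) = ι x ⊔ ι y
  orderDense : ∀ u : U, 0 < u → ∃ x : E, 0 < ι x ∧ ι x ≤ u
  laterallyComplete : ∀ S : Set U, S.Nonempty → (∀ u ∈ S, 0 ≤ u) →
    (∀ u ∈ S, ∀ v ∈ S, u ≠ v → u ⊓ v = 0) → ∃ s, IsLUB S s

/-- `f ∈ dom T`: `f` is an element of the positive cone of `E^u` and the supremum of an upwards
directed family in `E₊` whose image under `T` is order bounded in `E^u`. -/
def InDom (ι : E →ₗ[ℝ] U) (T : E →ₗ[ℝ] E) (f : U) : Prop :=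
  0 ≤ f ∧ ∃ D : Set E, D.Nonempty ∧ DirectedOn (· ≤ ·) D ∧ (∀ x ∈ D, 0 ≤ x) ∧
    IsLUB (ι '' D) f ∧ BddAbove (ι '' (T '' D))

/-- The natural domain `L¹(T) = dom T - dom T ⊆ E^u`. -/
def naturalDomain (ι : E →ₗ[ℝ] U) (T : E →ₗ[ℝ] E) : Set U :=
  {f | ∃ g h : U, InDom ι T g ∧ InDom ι T h ∧ f = g - h}

/-- The component `P_g e = sup_n (e ∧ n g)` of `e` in the band generated by `g ≥ 0`. -/
noncomputable def bandComponent (e g : U) : U :=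
  ⨆ n : ℕ, e ⊓ ((n : ℝ) • g)

/-- `h = x ^ p` for `x ≥ 0`, by functional calculus with respect to the unit `e`: `h` is the
spectral integral `∫ t ^ p dE_t` of `t ↦ t ^ p` against the spectral system
`E_t = I - P_{(x - t e)⁺}` of `x`. As `t ↦ t ^ p` is increasing, the lower sum of this integral
at points `0 ≤ t_0 < ⋯ < t_m` (with `t_{m+1} = ∞`), namely `∑ t_k ^ p (E_{t_{k+1}} - E_{t_k}) e`,
is the join of the elements `t_k ^ p P_{(x - t_k e)⁺} e`. So the supremum of all lower sums is
the supremum of the elements `t ^ p P_{(x - t e)⁺} e`, `t ≥ 0`. -/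
def IsRpow (e : U) (p : ℝ) (x h : U) : Prop :=
  IsLUB {u : U | ∃ t : ℝ, 0 ≤ t ∧ u = t ^ p • bandComponent e ((x - t • e) ⊔ 0)} h

/-- `x ∈ L^p(T)`, where `E = L¹(T)`: the power `|x| ^ p`, formed in `E^u`, belongs to `L¹(T)`. -/
def MemLp (ι : E →ₗ[ℝ] U) (e : E) (p : ℝ) (x : E) : Prop :=
  ∃ z : E, IsRpow (ι e) p |ι x| (ι z)

/-- The element `|x| ^ p` of `E = L¹(T)`, for `x ∈ L^p(T)`. -/
noncomputable def MemLp.absRpow {ι : E →ₗ[ℝ] U} {e : E} {p : ℝ} {x : E}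
    (h : MemLp ι e p x) : E :=
  h.choose

end UniversalCompletion

end RieszSpace

set_option linter.unusedSectionVars false

namespace RieszSpace

/-! ### Scalars, lattice operations and absolute values. -/

section LatticeModule

variable {E : Type*} [Lattice E] [AddCommGroup E] [IsOrderedAddMonoid E]
  [Module ℝ E] [IsOrderedModule ℝ E]

/-! By Kronecker's lemma it suffices that the partial sums of y_i = Y_i / a_i, taken from the second
index on, are order Cauchy. With q_i = |Y_i|^p / a_i^p, the identity T F_0 = T turns the convergence
of the given series into an order bound for T(q_0 + ... + q_n).

Cut y_i off at ±e. The excess is at most (|y_i| - e)⁺ ≤ q_i because p ≥ 1. The truncation has square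
at most q_i because p ≤ 2, and once recentred it is a martingale difference X_i inside the order
ideal generated by e. Doob's L² inequality, in the linear form T(max |∑ X_i|) ≤ (c/2) e + (8/c) ∑ T
q_i for every c > 0 (`map_runningMax_le`), shows that T of the tail maxima decreases to 0. Strict
positivity of T transfers this to the maxima themselves (`exists_tail_bound`).

Two tools carry the argument. In the ideal of e, the unital Riesz homomorphisms into ℝ determine the
order (`IsStrongUnit.le_of_forall_char`), so squares, products and powers can be handled pointwise
and real inequalities transfer. And an increasing positive sequence with T-images bounded in E is
itself bounded in E (`exists_bound_of_map_le`): lateral completeness bounds it in the universal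
completion, and E = L¹(T) brings its supremum back to E. -/

lemma smul_sup_of_nonneg {c : ℝ} (hc : 0 ≤ c) (x y : E) : c • (x ⊔ y) = c • x ⊔ c • y := by
  rcases hc.eq_or_lt with rfl | hc
  · simp
  · exact (OrderIso.smulRight (β := E) hc).map_sup x y

lemma smul_inf_of_nonneg {c : ℝ} (hc : 0 ≤ c) (x y : E) : c • (x ⊓ y) = c • x ⊓ c • y := by
  rcases hc.eq_or_lt with rfl | hc
  · simp
  · exact (OrderIso.smulRight (β := E) hc).map_inf x y

lemma abs_smul_of_nonneg {c : ℝ} (hc : 0 ≤ c) (x : E) : |c • x| = c • |x| := by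
  simp only [abs, smul_sup_of_nonneg hc, smul_neg]

lemma abs_sum_le (f : ℕ → E) (s : Finset ℕ) : |∑ i ∈ s, f i| ≤ ∑ i ∈ s, |f i| :=
  Finset.le_sum_of_subadditive _ abs_zero.le (fun x y => abs_add_le x y) s f

end LatticeModule

/-! ### Real-valued Riesz homomorphisms and the order they determine. -/

section Characters

variable {A : Type*} [Lattice A] [AddCommGroup A] [IsOrderedAddMonoid A]
  [Module ℝ A] [IsOrderedModule ℝ A]

/-- `e ≥ 0` is a strong order unit with respect to which the space is Archimedean. -/
structure IsStrongUnit (e : A) : Prop where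
  nonneg : 0 ≤ e
  bound : ∀ x, ∃ c : ℝ, x ≤ c • e
  arch : ∀ x, (∀ ε : ℝ, 0 < ε → x ≤ ε • e) → x ≤ 0

/-- A unital Riesz homomorphism into the real numbers. -/
structure UnitChar (e : A) extends A →ₗ[ℝ] ℝ where
  map_sup' : ∀ x y, toFun (x ⊔ y) = max (toFun x) (toFun y)
  map_unit' : toFun e = 1

/-- A sublinear functional that preserves binary suprema. -/
structure IsMaxSublinear (p : A → ℝ) : Prop where
  add_le : ∀ x y, p (x + y) ≤ p x + p y
  smul : ∀ c : ℝ, 0 < c → ∀ x, p (c • x) = c * p x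
  sup : ∀ x y, p (x ⊔ y) = max (p x) (p y)

namespace IsMaxSublinear

variable {p : A → ℝ}

lemma map_zero (hp : IsMaxSublinear p) : p 0 = 0 := by
  have := hp.smul 2 two_pos 0
  rw [smul_zero] at this
  linarith

lemma mono (hp : IsMaxSublinear p) : Monotone p := fun x y h => by
  have := hp.sup x y
  rw [sup_eq_right.2 h] at this
  exact this ▸ le_max_left _ _

lemma neg_le (hp : IsMaxSublinear p) (x : A) : -p (-x) ≤ p x := by
  have := hp.add_le x (-x)
  rw [add_neg_cancel, hp.map_zero] at this
  linarith

end IsMaxSublinear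

/-- An infimum preserves binary suprema only when the family is directed downwards in a suitable
sense, which the witnesses k provide. This covers both the derivative at infinity and lower bounds
of chains in Zorn's lemma. -/
lemma isMaxSublinear_iInf {I : Type*} [Nonempty I] (f : I → A → ℝ)
    (hadd : ∀ i j x y, ∃ k, f k (x + y) ≤ f i x + f j y)
    (hsmul : ∀ c : ℝ, 0 < c → ∀ i x, ∃ k, f k (c • x) ≤ c * f i x)
    (hsup : ∀ i j x y, ∃ k, f k (x ⊔ y) ≤ max (f i x) (f j y))
    (hmono : ∀ i, Monotone (f i))
    (hbdd : ∀ x, BddBelow (Set.range fun i => f i x)) :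
    IsMaxSublinear fun x => ⨅ i, f i x := by
  have key : ∀ c : ℝ, 0 < c → ∀ x, (⨅ i, f i (c • x)) ≤ c * ⨅ i, f i x := by
    intro c hc x
    rw [Real.mul_iInf_of_nonneg hc.le]
    refine le_ciInf fun i => ?_
    obtain ⟨k, hk⟩ := hsmul c hc i x
    exact (ciInf_le (hbdd _) k).trans hk
  refine ⟨fun x y => ?_, fun c hc x => (key c hc x).antisymm ?_, fun x y => le_antisymm ?_ ?_⟩
  · refine le_ciInf_add_ciInf fun i j => ?_
    obtain ⟨k, hk⟩ := hadd i j x y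
    exact (ciInf_le (hbdd _) k).trans hk
  · have := key c⁻¹ (inv_pos.2 hc) (c • x)
    rw [smul_smul, inv_mul_cancel₀ hc.ne', one_smul] at this
    have h2 := mul_le_mul_of_nonneg_left this hc.le
    rwa [← mul_assoc, mul_inv_cancel₀ hc.ne', one_mul] at h2
  · refine le_of_forall_gt fun r hr => ?_
    obtain ⟨hx, hy⟩ := max_lt_iff.1 hr
    obtain ⟨i, hi⟩ := exists_lt_of_ciInf_lt hx
    obtain ⟨j, hj⟩ := exists_lt_of_ciInf_lt hy
    obtain ⟨k, hk⟩ := hsup i j x y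
    exact ((ciInf_le (hbdd _) k).trans hk).trans_lt (max_lt hi hj)
  · exact max_le (ciInf_mono (hbdd _) fun i => hmono i le_sup_left)
      (ciInf_mono (hbdd _) fun i => hmono i le_sup_right)

/-- The directional derivative at infinity, `inf_t (p (x + t a) - t p a)`. -/
lemma IsMaxSublinear.exists_le_add_eq {p : A → ℝ} (hp : IsMaxSublinear p) (a : A) :
    ∃ q : A → ℝ, IsMaxSublinear q ∧ (∀ x, q x ≤ p x) ∧ ∀ x, q x ≤ p (x + a) - p a := by
  let f : Set.Ici (0 : ℝ) → A → ℝ := fun t x => p (x + (t : ℝ) • a) - t * p a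
  have hsm : ∀ t : ℝ, 0 ≤ t → p (t • a) = t * p a := fun t ht => by
    rcases ht.eq_or_lt with rfl | ht
    · simp [hp.map_zero]
    · exact hp.smul t ht a
  -- Subadditivity makes f decrease in t, so the infimum is a limit as t grows and two parameters
  -- can be replaced by their maximum.
  have hanti : ∀ (s t : Set.Ici (0 : ℝ)) x, s ≤ t → f t x ≤ f s x := by
    rintro ⟨s, hs⟩ ⟨t, ht⟩ x hst
    have hst' : s ≤ t := hst
    have h := hp.add_le (x + s • a) ((t - s) • a)
    rw [hsm _ (sub_nonneg.2 hst'), add_assoc, ← add_smul, add_sub_cancel] at h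
    simp only [f]
    linarith
  have hmono : ∀ i, Monotone (f i) := fun i x y h =>
    sub_le_sub_right (hp.mono (add_le_add_left h _)) _
  have hbdd : ∀ x, BddBelow (Set.range fun i => f i x) := by
    intro x
    refine ⟨-p (-x), ?_⟩
    rintro _ ⟨⟨t, ht⟩, rfl⟩
    have h := hp.add_le (x + t • a) (-x)
    rw [add_neg_cancel_comm, hsm t ht] at h
    simp only [f]
    linarith
  refine ⟨fun x => ⨅ i, f i x, isMaxSublinear_iInf f ?_ ?_ ?_ hmono hbdd, fun x => ?_,
    fun x => ?_⟩
  · rintro ⟨s, hs⟩ ⟨t, ht⟩ x y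
    refine ⟨⟨s + t, Set.mem_Ici.2 (add_nonneg hs ht)⟩, ?_⟩
    have h := hp.add_le (x + s • a) (y + t • a)
    rw [add_add_add_comm, ← add_smul] at h
    simp only [f]
    linarith
  · rintro c hc ⟨t, ht⟩ x
    refine ⟨⟨c * t, Set.mem_Ici.2 (mul_nonneg hc.le ht)⟩, ?_⟩
    simp only [f]
    rw [mul_smul, ← smul_add, hp.smul c hc]
    linarith
  · intro s t x y
    refine ⟨s ⊔ t, ?_⟩
    have h : f (s ⊔ t) (x ⊔ y) = max (f (s ⊔ t) x) (f (s ⊔ t) y) := by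
      simp only [f]
      rw [sup_add, hp.sup, max_sub_sub_right]
    rw [h]
    exact max_le_max (hanti _ _ _ le_sup_left) (hanti _ _ _ le_sup_right)
  · refine (ciInf_le (hbdd x) ⟨0, Set.self_mem_Ici⟩).trans ?_
    simp [f]
  · refine (ciInf_le (hbdd x) ⟨1, Set.mem_Ici.2 zero_le_one⟩).trans ?_
    simp [f]

/-- Every sublinear functional preserving suprema dominates a linear one. -/
lemma IsMaxSublinear.exists_linear_le {p : A → ℝ} (hp : IsMaxSublinear p) :
    ∃ q : A → ℝ, IsMaxSublinear q ∧ (∀ x, q x ≤ p x) ∧ ∀ x y, q (x + y) = q x + q y := by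
  let S := {q : A → ℝ // IsMaxSublinear q ∧ ∀ x, q x ≤ p x}
  have : Nonempty S := ⟨⟨p, hp, fun _ => le_rfl⟩⟩
  obtain ⟨⟨q, hq, hqp⟩, hmax⟩ := exists_maximal_of_nonempty_chains_bounded
    (r := fun q r : S => ∀ x, r.1 x ≤ q.1 x) (fun c hc hne => by
      have : Nonempty c := hne.to_subtype
      have hbdd : ∀ x, BddBelow (Set.range fun i : c => i.1.1 x) := fun x => by
        refine ⟨-p (-x), ?_⟩
        rintro _ ⟨i, rfl⟩
        exact (neg_le_neg (i.1.2.2 _)).trans (i.1.2.1.neg_le x)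
      have hdir : ∀ i j : c, ∃ k : c, (∀ x, k.1.1 x ≤ i.1.1 x) ∧ ∀ x, k.1.1 x ≤ j.1.1 x := by
        intro i j
        rcases eq_or_ne i.1 j.1 with h | h
        · exact ⟨i, fun _ => le_rfl, fun x => h ▸ le_rfl⟩
        · rcases hc i.2 j.2 h with h | h
          · exact ⟨j, h, fun _ => le_rfl⟩
          · exact ⟨i, fun _ => le_rfl, h⟩
      refine ⟨⟨fun x => ⨅ i : c, i.1.1 x, isMaxSublinear_iInf (fun i : c => i.1.1) ?_ ?_ ?_
        (fun i => i.1.2.1.mono) hbdd, fun x => ?_⟩, fun a ha x => ciInf_le (hbdd x) ⟨a, ha⟩⟩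
      · intro i j x y
        obtain ⟨k, hi, hj⟩ := hdir i j
        exact ⟨k, (k.1.2.1.add_le x y).trans (add_le_add (hi _) (hj _))⟩
      · exact fun c hc i x => ⟨i, (i.1.2.1.smul c hc x).le⟩
      · intro i j x y
        obtain ⟨k, hi, hj⟩ := hdir i j
        exact ⟨k, (k.1.2.1.sup x y).le.trans (max_le_max (hi _) (hj _))⟩
      · obtain ⟨i⟩ := ‹Nonempty c›
        exact (ciInf_le (hbdd x) i).trans (i.1.2.2 x))
    (fun h1 h2 x => (h2 x).trans (h1 x))
  refine ⟨q, hq, hqp, fun x y => (hq.add_le x y).antisymm ?_⟩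
  -- The derivative r of the minimal q in direction y lies below q, so by minimality q ≤ r; the
  -- bound r x ≤ q (x + y) - q y then gives superadditivity.
  obtain ⟨r, hr, hrq, hra⟩ := hq.exists_le_add_eq y
  have := hmax ⟨r, hr, fun x => (hrq x).trans (hqp x)⟩ hrq x
  have h2 := hra x
  simp only at this
  linarith

namespace IsStrongUnit

variable {e : A}

/-- Take for p x the least t with x ≤ t e; it is attained by the Archimedean property. Suprema are
preserved because x ⊔ y ≤ t e means x ≤ t e and y ≤ t e. -/
lemma exists_maxSublinear (he : IsStrongUnit e) (hne : e ≠ 0) :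
    ∃ p : A → ℝ, IsMaxSublinear p ∧ ∀ x t, p x ≤ t ↔ x ≤ t • e := by
  have hle : ∀ c : ℝ, 0 ≤ c • e → 0 ≤ c := fun c hc => by
    by_contra! h
    have h1 := smul_nonneg (inv_nonneg.2 (neg_pos.2 h).le) hc
    rw [smul_smul, inv_neg, neg_mul, inv_mul_cancel₀ h.ne, neg_smul, one_smul] at h1
    exact hne (le_antisymm (neg_nonneg.1 h1) he.nonneg)
  have hbdd : ∀ x, BddBelow {t : ℝ | x ≤ t • e} := fun x => by
    obtain ⟨c, hc⟩ := he.bound (-x)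
    refine ⟨-c, fun t ht => ?_⟩
    have : 0 ≤ (t + c) • e := by
      rw [add_smul]
      have := add_le_add ht hc
      rwa [add_neg_cancel] at this
    linarith [hle _ this]
  have hiff : ∀ x t, sInf {t : ℝ | x ≤ t • e} ≤ t ↔ x ≤ t • e := by
    refine fun x t => ⟨fun h => ?_, fun h => csInf_le (hbdd x) h⟩
    refine sub_nonpos.1 (he.arch _ fun ε hε => ?_)
    obtain ⟨s, hs, hst⟩ := exists_lt_of_csInf_lt (he.bound x) (h.trans_lt (lt_add_of_pos_right t hε))
    rw [sub_le_iff_le_add, ← add_smul, add_comm]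
    exact le_trans hs (smul_le_smul_of_nonneg_right hst.le he.nonneg)
  have hsm : ∀ c : ℝ, 0 < c → ∀ x, sInf {t : ℝ | c • x ≤ t • e} ≤ c * sInf {t : ℝ | x ≤ t • e} := by
    intro c hc x
    rw [hiff, mul_smul]
    exact smul_le_smul_of_nonneg_left ((hiff _ _).1 le_rfl) hc.le
  refine ⟨fun x => sInf {t : ℝ | x ≤ t • e}, ⟨fun x y => ?_, fun c hc x => ?_, fun x y => ?_⟩, hiff⟩
  · rw [hiff, add_smul]
    exact add_le_add ((hiff _ _).1 le_rfl) ((hiff _ _).1 le_rfl)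
  · refine (hsm c hc x).antisymm ?_
    have := hsm c⁻¹ (inv_pos.2 hc) (c • x)
    rw [smul_smul, inv_mul_cancel₀ hc.ne', one_smul] at this
    have h2 := mul_le_mul_of_nonneg_left this hc.le
    rwa [← mul_assoc, mul_inv_cancel₀ hc.ne', one_mul] at h2
  · refine eq_of_forall_ge_iff fun t => ?_
    rw [hiff, max_le_iff, hiff, hiff, sup_le_iff]

/-- Unital Riesz homomorphisms into `ℝ` determine the order. -/
theorem le_of_forall_char (he : IsStrongUnit e) {x y : A}
    (h : ∀ ω : UnitChar e, ω.toLinearMap x ≤ ω.toLinearMap y) : x ≤ y := by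
  rw [← sub_nonpos]
  refine he.arch _ fun ε hε => ?_
  by_contra hx
  have hne : e ≠ 0 := by
    rintro rfl
    exact hx ((he.arch _ fun δ _ => (he.bound (x - y)).elim (by simp)).trans (by simp))
  obtain ⟨N, hN, hiff⟩ := he.exists_maxSublinear hne
  obtain ⟨p, hp, hpN, hpx⟩ := hN.exists_le_add_eq (x - y)
  obtain ⟨q, hq, hqp, hadd⟩ := hp.exists_linear_le
  have hq0 := hq.map_zero
  have hneg : ∀ z, q (-z) = -q z := fun z => by
    have := hadd z (-z)
    rw [add_neg_cancel, hq0] at this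
    linarith
  have hlin : ∀ (c : ℝ) z, q (c • z) = c * q z := fun c z => by
    rcases lt_trichotomy c 0 with hc | rfl | hc
    · have := hq.smul (-c) (neg_pos.2 hc) z
      rw [neg_smul, hneg] at this
      linarith
    · simp [hq0]
    · exact hq.smul c hc z
  have h1 : q e ≤ 1 := (hqp e).trans ((hpN e).trans ((hiff _ _).2 (by simp)))
  have h2 : q (-e) ≤ -1 := (hqp _).trans ((hpN _).trans ((hiff _ _).2 (by simp)))
  rw [hneg] at h2
  let ω : UnitChar e :=
    { toFun := q, map_add' := hadd, map_smul' := hlin, map_sup' := hq.sup,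
      map_unit' := by linarith }
  have h3 : q x ≤ q y := h ω
  -- Differentiating N in direction x - y and evaluating at -(x - y) forces q to be at least N at x
  -- - y, hence greater than ε, against q x ≤ q y.
  have h4 : q (-(x - y)) ≤ -N (x - y) := by
    refine (hqp _).trans ((hpx _).trans ?_)
    rw [neg_add_cancel, hN.map_zero, zero_sub]
  have h5 : q (x - y) = q x - q y := by rw [sub_eq_add_neg, hadd, hneg, sub_eq_add_neg]
  have h6 : ε < N (x - y) := by
    by_contra! h
    exact hx ((hiff _ _).1 h)
  rw [hneg, h5] at h4
  linarith

end IsStrongUnit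

end Characters

/-! ### Pointwise squares and products, Jensen's inequality, averaging. -/

section Algebra

variable {A : Type*} [Lattice A] [AddCommGroup A] [IsOrderedAddMonoid A]
  [Module ℝ A] [IsOrderedModule ℝ A] {e : A}

namespace UnitChar

instance : FunLike (UnitChar e) A ℝ where
  coe ω := ω.toFun
  coe_injective ω ψ h := by
    cases ω; cases ψ; congr; exact DFunLike.coe_injective h

instance : LinearMapClass (UnitChar e) ℝ A ℝ where
  map_add ω := ω.map_add'
  map_smulₛₗ ω := ω.map_smul'

variable (ω : UnitChar e)

lemma map_unit : ω e = 1 := ω.map_unit'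

lemma map_sup (x y : A) : ω (x ⊔ y) = max (ω x) (ω y) := ω.map_sup' x y

lemma map_inf (x y : A) : ω (x ⊓ y) = min (ω x) (ω y) := by
  have h := congrArg ω (inf_add_sup x y)
  rw [map_add, map_add, map_sup] at h
  linarith [min_add_max (ω x) (ω y)]

lemma map_abs (x : A) : ω |x| = |ω x| := by
  rw [abs, map_sup, map_neg]
  rfl

lemma mono {x y : A} (h : x ≤ y) : ω x ≤ ω y := by
  have := ω.map_sup x y
  rw [sup_eq_right.2 h] at this
  exact this ▸ le_max_left _ _

end UnitChar

lemma IsStrongUnit.le_of_char (he : IsStrongUnit e) {x y : A}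
    (h : ∀ ω : UnitChar e, ω x ≤ ω y) : x ≤ y := he.le_of_forall_char h

lemma IsStrongUnit.eq_of_char (he : IsStrongUnit e) {x y : A}
    (h : ∀ ω : UnitChar e, ω x = ω y) : x = y :=
  (he.le_of_char fun ω => (h ω).le).antisymm (he.le_of_char fun ω => (h ω).ge)

/-- `b` is the square of `a`, computed pointwise on the characters. -/
def IsSquare (e a b : A) : Prop := ∀ ω : UnitChar e, ω b = ω a ^ 2

/-- `c` is the product of `a` and `b`, computed pointwise on the characters. -/
def IsProduct (e a b c : A) : Prop := ∀ ω : UnitChar e, ω c = ω a * ω b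

/-- Suprema of nonempty bounded sets exist. -/
def HasSups (A : Type*) [Preorder A] : Prop :=
  ∀ S : Set A, S.Nonempty → BddAbove S → ∃ s, IsLUB S s

/-- A bound of `a ^ 2` from above that is exact at a given character. -/
lemma IsStrongUnit.exists_bound (he : IsStrongUnit e) (a : A) :
    ∃ m : ℝ, 0 ≤ m ∧ (∀ ω : UnitChar e, |ω a| ≤ m) ∧ ∀ (α : ℝ), |α| ≤ m → ∀ ω : UnitChar e,
      ω a ^ 2 ≤ ω (α ^ 2 • e + (2 * m) • |a - α • e|) := by
  obtain ⟨m', hm'⟩ := he.bound |a|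
  obtain ⟨m, hmm, hm0⟩ : ∃ m, m' ≤ m ∧ 0 ≤ m := ⟨max m' 0, le_max_left _ _, le_max_right _ _⟩
  have hm : |a| ≤ m • e := hm'.trans (smul_le_smul_of_nonneg_right hmm he.nonneg)
  have h1 : ∀ ω : UnitChar e, |ω a| ≤ m := fun ω => by
    have h1 := ω.mono hm
    rwa [ω.map_abs, map_smul, ω.map_unit, smul_eq_mul, mul_one] at h1
  refine ⟨m, hm0, h1, fun α hα ω => ?_⟩
  rw [map_add, map_smul, map_smul, ω.map_unit, ω.map_abs, map_sub, map_smul, ω.map_unit]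
  simp only [smul_eq_mul, mul_one]
  have h2 : ω a ^ 2 - α ^ 2 ≤ |ω a - α| * (2 * m) := by
    calc ω a ^ 2 - α ^ 2 = (ω a - α) * (ω a + α) := by ring
      _ ≤ |(ω a - α) * (ω a + α)| := le_abs_self _
      _ = |ω a - α| * |ω a + α| := abs_mul _ _
      _ ≤ |ω a - α| * (2 * m) := by
        refine mul_le_mul_of_nonneg_left ?_ (abs_nonneg _)
        linarith [abs_add_le (ω a) α, h1 ω]
  linarith

/-- The square is the supremum of its tangents 2 s a - s² e. A character need not commute with this
supremum, but a tangent from below and the bound of `exists_bound` from above are both exact at ω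
when taken at ω a. -/
lemma IsStrongUnit.exists_isSquare (he : IsStrongUnit e) (hA : HasSups A) (a : A) :
    ∃ b, IsSquare e a b := by
  obtain ⟨m, hm0, hm1, hm⟩ := he.exists_bound a
  have hub : ∀ α : ℝ, |α| ≤ m → α ^ 2 • e + (2 * m) • |a - α • e| ∈
      upperBounds (Set.range fun s : ℝ => (2 * s) • a - s ^ 2 • e) := by
    rintro α hα _ ⟨s, rfl⟩
    refine he.le_of_char fun ω => le_trans ?_ (hm α hα ω)
    rw [map_sub, map_smul, map_smul, ω.map_unit]
    simp only [smul_eq_mul]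
    nlinarith [sq_nonneg (ω a - s)]
  obtain ⟨b, hb⟩ := hA _ (Set.range_nonempty _) ⟨_, hub 0 (by simpa using hm0)⟩
  refine ⟨b, fun ω => le_antisymm ?_ ?_⟩
  · have h := ω.mono (hb.2 (hub (ω a) (hm1 ω)))
    rw [map_add, map_smul, map_smul, ω.map_unit, ω.map_abs, map_sub, map_smul, ω.map_unit] at h
    simpa using h
  · have h := ω.mono (hb.1 ⟨ω a, rfl⟩)
    rw [map_sub, map_smul, map_smul, ω.map_unit] at h
    simp only [smul_eq_mul] at h
    linarith

lemma IsStrongUnit.exists_isProduct (he : IsStrongUnit e) (hA : HasSups A) (a b : A) :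
    ∃ c, IsProduct e a b c := by
  obtain ⟨u, hu⟩ := he.exists_isSquare hA (a + b)
  obtain ⟨v, hv⟩ := he.exists_isSquare hA (a - b)
  refine ⟨(4⁻¹ : ℝ) • (u - v), fun ω => ?_⟩
  rw [map_smul, map_sub, hu ω, hv ω, map_add, map_sub, smul_eq_mul]
  ring

/-- A positive unital linear projection whose range is a Riesz subspace. -/
structure IsUnitalCondExp (e : A) (F : A →ₗ[ℝ] A) : Prop where
  positive : ∀ x, 0 ≤ x → 0 ≤ F x
  unit : F e = e
  projection : ∀ x, F (F x) = F x
  sup_fixed : ∀ x y, F x = x → F y = y → F (x ⊔ y) = x ⊔ y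

namespace IsUnitalCondExp

variable {F : A →ₗ[ℝ] A}

lemma mono (hF : IsUnitalCondExp e F) : Monotone F := fun x y h => by
  have := hF.positive (y - x) (sub_nonneg.2 h)
  rwa [map_sub, sub_nonneg] at this

lemma abs_fixed (hF : IsUnitalCondExp e F) {x : A} (hx : F x = x) : F |x| = |x| :=
  hF.sup_fixed _ _ hx (by rw [map_neg, hx])

/-- The conditional Jensen inequality for squares. -/
lemma sq_le (hF : IsUnitalCondExp e F) (he : IsStrongUnit e) {a b : A}
    (hb : ∀ ω : UnitChar e, ω a ^ 2 ≤ ω b) (ω : UnitChar e) : ω (F a) ^ 2 ≤ ω (F b) := by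
  -- The tangent to the square at the real number ω (F a).
  have h : (2 * ω (F a)) • a - ω (F a) ^ 2 • e ≤ b := he.le_of_char fun ψ => by
    rw [map_sub, map_smul, map_smul, ψ.map_unit]
    simp only [smul_eq_mul]
    nlinarith [sq_nonneg (ψ a - ω (F a)), hb ψ]
  have h2 := ω.mono (hF.mono h)
  rw [map_sub, map_smul, map_smul, hF.unit, map_sub, map_smul, map_smul, ω.map_unit] at h2
  simp only [smul_eq_mul] at h2
  linarith

/-- Jensen gives one direction. For the other, the upper bound of `exists_bound` at α = ω a is built
from a, e and an absolute value, so F fixes it, and it is exact at ω. -/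
lemma sq_fixed (hF : IsUnitalCondExp e F) (he : IsStrongUnit e) {a b : A} (ha : F a = a)
    (hb : IsSquare e a b) (ω : UnitChar e) : ω (F b) = ω a ^ 2 := by
  refine le_antisymm ?_ (by simpa [ha] using hF.sq_le he (fun ψ => (hb ψ).ge) ω)
  obtain ⟨m, -, hm1, hm⟩ := he.exists_bound a
  have h : b ≤ ω a ^ 2 • e + (2 * m) • |a - ω a • e| :=
    he.le_of_char fun ψ => (hb ψ).le.trans (hm _ (hm1 ω) ψ)
  have hfix : F |a - ω a • e| = |a - ω a • e| :=
    hF.abs_fixed (by rw [map_sub, map_smul, ha, hF.unit])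
  have h2 := ω.mono (hF.mono h)
  rw [map_add, map_smul, map_smul, hF.unit, hfix, map_add, map_smul, map_smul, ω.map_unit,
    ω.map_abs, map_sub, map_smul, ω.map_unit] at h2
  simpa using h2

/-- The averaging property `F (a b) = a F b` for `a` in the range of `F`. -/
lemma averaging (hF : IsUnitalCondExp e F) (he : IsStrongUnit e) (hA : HasSups A) {a b c : A}
    (ha : F a = a) (hc : IsProduct e a b c) : IsProduct e a (F b) (F c) := by
  intro ω
  obtain ⟨u, hu⟩ := he.exists_isSquare hA a
  obtain ⟨v, hv⟩ := he.exists_isSquare hA b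
  -- Jensen for a + t b: the constant terms cancel because F fixes a and its square. The remaining
  -- quadratic in t is nonnegative everywhere, so its linear coefficient vanishes.
  have key : ∀ t : ℝ, 0 ≤ 2 * t * (ω (F c) - ω a * ω (F b)) + t ^ 2 * (ω (F v) - ω (F b) ^ 2) := by
    intro t
    have h := hF.sq_le he (a := a + t • b) (b := u + (2 * t) • c + t ^ 2 • v) (fun ψ => by
      simp only [map_add, map_smul, hu ψ, hv ψ, hc ψ, smul_eq_mul]
      apply le_of_eq
      ring) ω
    simp only [map_add, map_smul, smul_eq_mul, hF.sq_fixed he ha hu ω, ha] at h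
    linarith
  set x := ω (F c) - ω a * ω (F b)
  set y := ω (F v) - ω (F b) ^ 2
  have hx : x = 0 := by
    by_contra hx
    have h := key (-x / (|y| + 1))
    have hy : 0 < |y| + 1 := by positivity
    have h2 : 2 * (-x / (|y| + 1)) * x + (-x / (|y| + 1)) ^ 2 * y =
        x ^ 2 / (|y| + 1) ^ 2 * (y - 2 * (|y| + 1)) := by
      field_simp
      ring
    rw [h2] at h
    have h3 : 0 < x ^ 2 / (|y| + 1) ^ 2 := by positivity
    have h4 := nonneg_of_mul_nonneg_right h h3
    linarith [le_abs_self y, abs_nonneg y]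
  linarith

end IsUnitalCondExp

end Algebra

/-! ### Doob's maximal inequality in a space with a strong unit. -/

section MaximalInequality

variable {A : Type*} [Lattice A] [AddCommGroup A] [IsOrderedAddMonoid A]
  [Module ℝ A] [IsOrderedModule ℝ A] {e : A}

/-- The running maximum `max_{j ≤ n} |∑_{i < j} X i|`. -/
def runningMax (X : ℕ → A) : ℕ → A
  | 0 => 0
  | n + 1 => runningMax X n ⊔ |∑ i ∈ Finset.range (n + 1), X i|

lemma runningMax_mono (X : ℕ → A) : Monotone (runningMax X) :=
  monotone_nat_of_le_succ fun _ => le_sup_left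

lemma runningMax_nonneg (X : ℕ → A) (n : ℕ) : 0 ≤ runningMax X n :=
  runningMax_mono X (Nat.zero_le n)

lemma abs_sum_le_runningMax (X : ℕ → A) (n : ℕ) :
    |∑ i ∈ Finset.range n, X i| ≤ runningMax X n := by
  cases n with
  | zero => simp [runningMax]
  | succ n => exact le_sup_right

/-- A martingale difference sequence for unital conditional expectations on a space with a
strong unit, together with a positive operator `T` that absorbs the conditional expectations. -/
structure IsBoundedMartingaleDifference (e : A) (T : A →ₗ[ℝ] A) (F : ℕ → A →ₗ[ℝ] A)
    (X : ℕ → A) : Prop where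
  condExp : ∀ n, IsUnitalCondExp e (F n)
  fixed_mono : ∀ n x, F n x = x → F (n + 1) x = x
  T_positive : ∀ x, 0 ≤ x → 0 ≤ T x
  T_unit : T e = e
  T_comp : ∀ n x, T (F n x) = T x
  adapted : ∀ n, F (n + 1) (X n) = X n
  condExp_eq_zero : ∀ n, F n (X n) = 0

namespace IsBoundedMartingaleDifference

variable {T : A →ₗ[ℝ] A} {F : ℕ → A →ₗ[ℝ] A} {X : ℕ → A}

lemma T_mono (h : IsBoundedMartingaleDifference e T F X) : Monotone T := fun x y hxy => by
  have := h.T_positive (y - x) (sub_nonneg.2 hxy)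
  rwa [map_sub, sub_nonneg] at this

lemma sum_fixed (h : IsBoundedMartingaleDifference e T F X) (n : ℕ) :
    F n (∑ i ∈ Finset.range n, X i) = ∑ i ∈ Finset.range n, X i := by
  induction n with
  | zero => simp
  | succ n ih => rw [Finset.sum_range_succ, map_add, h.fixed_mono _ _ ih, h.adapted]

lemma runningMax_fixed (h : IsBoundedMartingaleDifference e T F X) (n : ℕ) :
    F n (runningMax X n) = runningMax X n := by
  induction n with
  | zero => simp [runningMax]
  | succ n ih =>
    exact (h.condExp _).sup_fixed _ _ (h.fixed_mono _ _ ih)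
      ((h.condExp _).abs_fixed (h.sum_fixed _))

lemma T_product_nonneg (h : IsBoundedMartingaleDifference e T F X) (he : IsStrongUnit e)
    (hA : HasSups A) {n : ℕ} {a b c : A} (ha : F n a = a) (ha0 : 0 ≤ a) (hb : 0 ≤ F n b)
    (hc : IsProduct e a b c) : 0 ≤ T c := by
  rw [← h.T_comp n]
  refine h.T_positive _ (he.le_of_char fun ω => ?_)
  rw [map_zero, (h.condExp n).averaging he hA ha hc ω]
  have h1 := ω.mono ha0
  have h2 := ω.mono hb
  rw [map_zero] at h1 h2
  exact mul_nonneg h1 h2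

/-- Orthogonality of martingale differences: averaging turns the cross term T(S_n X_n) into T(S_n
F_n X_n) = 0. -/
lemma T_sq_sum_le (h : IsBoundedMartingaleDifference e T F X) (he : IsStrongUnit e)
    (hA : HasSups A) {w : ℕ → A} (hw : ∀ i, ∀ ω : UnitChar e, ω (X i) ^ 2 ≤ ω (w i)) (n : ℕ)
    {b : A} (hb : IsSquare e (∑ i ∈ Finset.range n, X i) b) :
    T b ≤ ∑ i ∈ Finset.range n, T (w i) := by
  induction n generalizing b with
  | zero =>
    have : b = 0 := he.eq_of_char fun ω => by simp [hb ω]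
    simp [this]
  | succ n ih =>
    obtain ⟨b', hb'⟩ := he.exists_isSquare hA (∑ i ∈ Finset.range n, X i)
    obtain ⟨c, hc⟩ := he.exists_isProduct hA (∑ i ∈ Finset.range n, X i) (X n)
    have hle : b ≤ b' + (2 : ℝ) • c + w n := he.le_of_char fun ω => by
      rw [hb ω, Finset.sum_range_succ, map_add, map_add, map_add, map_smul, hb' ω, hc ω,
        smul_eq_mul]
      nlinarith [hw n ω]
    have hTc : T c = 0 := by
      rw [← h.T_comp n, he.eq_of_char (x := F n c) (y := 0), map_zero]
      intro ω
      rw [(h.condExp n).averaging he hA (h.sum_fixed n) hc ω, h.condExp_eq_zero, map_zero,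
        mul_zero]
    have := h.T_mono hle
    rw [map_add, map_add, map_smul, hTc, smul_zero, add_zero] at this
    rw [Finset.sum_range_succ]
    exact this.trans (add_le_add_left (ih hb') _)

/-- With M' = max(M, |D'|), pointwise M'² - M² ≤ 2 |D'| (M' - M). Since F_n |D'| ≥ |D|, averaging
gives T(M |D'|) ≥ T(M |D|), and the induction telescopes. -/
lemma T_sq_runningMax_le (h : IsBoundedMartingaleDifference e T F X) (he : IsStrongUnit e)
    (hA : HasSups A) (n : ℕ) {b c : A} (hb : IsSquare e (runningMax X n) b)
    (hc : IsProduct e (runningMax X n) |∑ i ∈ Finset.range n, X i| c) :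
    T b ≤ (2 : ℝ) • T c := by
  induction n generalizing b c with
  | zero =>
    have hb0 : b = 0 := he.eq_of_char fun ω => by simp [hb ω, runningMax]
    have hc0 : c = 0 := he.eq_of_char fun ω => by simp [hc ω, runningMax]
    simp [hb0, hc0]
  | succ n ih =>
    set D := ∑ i ∈ Finset.range n, X i with hD
    set D' := ∑ i ∈ Finset.range (n + 1), X i with hD'
    obtain ⟨b', hb'⟩ := he.exists_isSquare hA (runningMax X n)
    obtain ⟨c', hc'⟩ := he.exists_isProduct hA (runningMax X n) |D|
    obtain ⟨d, hd⟩ := he.exists_isProduct hA (runningMax X n) (|D'| - |D|)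
    have hFD : F n D' = D := by
      rw [hD', Finset.sum_range_succ, map_add, h.sum_fixed, h.condExp_eq_zero, add_zero]
    have hTd : 0 ≤ T d := by
      refine h.T_product_nonneg he hA (h.runningMax_fixed n) (runningMax_nonneg X n) ?_ hd
      rw [map_sub, (h.condExp n).abs_fixed (h.sum_fixed n), sub_nonneg, ← hD, ← hFD]
      refine abs_le'.2 ⟨?_, ?_⟩
      · exact (h.condExp n).mono (le_abs_self _)
      · rw [← map_neg]
        exact (h.condExp n).mono (neg_le_abs D')
    have hle : b + (2 : ℝ) • c' + (2 : ℝ) • d ≤ b' + (2 : ℝ) • c := he.le_of_char fun ω => by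
      have hm : ω (runningMax X (n + 1)) = max (ω (runningMax X n)) (ω |D'|) := ω.map_sup _ _
      simp only [map_add, map_smul, smul_eq_mul, hb ω, hc ω, hb' ω, hc' ω, hd ω, map_sub, hm]
      rcases max_cases (ω (runningMax X n)) (ω |D'|) with ⟨h1, h2⟩ | ⟨h1, h2⟩ <;> rw [h1] <;>
        nlinarith
    have h1 := h.T_mono hle
    simp only [map_add, map_smul] at h1
    have h2 := ih hb' hc'
    have h3 := smul_nonneg zero_le_two (α := ℝ) hTd
    calc T b ≤ T b + (2 : ℝ) • T d := le_add_of_nonneg_right h3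
      _ = (T b + (2 : ℝ) • T c' + (2 : ℝ) • T d) - (2 : ℝ) • T c' := by abel
      _ ≤ (T b' + (2 : ℝ) • T c) - (2 : ℝ) • T c' := sub_le_sub_right h1 _
      _ ≤ ((2 : ℝ) • T c' + (2 : ℝ) • T c) - (2 : ℝ) • T c' :=
        sub_le_sub_right (add_le_add_left h2 _) _
      _ = _ := by abel

/-- Doob's maximal inequality in linearized form. -/
theorem T_runningMax_le (h : IsBoundedMartingaleDifference e T F X) (he : IsStrongUnit e)
    (hA : HasSups A) {w : ℕ → A} (hw : ∀ i, ∀ ω : UnitChar e, ω (X i) ^ 2 ≤ ω (w i)) (n : ℕ)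
    {c : ℝ} (hc : 0 < c) :
    T (runningMax X n) ≤ (c / 2) • e + (2 / c) • ∑ i ∈ Finset.range n, T (w i) := by
  obtain ⟨b, hb⟩ := he.exists_isSquare hA (runningMax X n)
  obtain ⟨d, hd⟩ := he.exists_isProduct hA (runningMax X n) |∑ i ∈ Finset.range n, X i|
  obtain ⟨s, hs⟩ := he.exists_isSquare hA (∑ i ∈ Finset.range n, X i)
  -- Two completed squares, chosen so that under T the terms x²/c and 2x|y|/c cancel through T b ≤ 2
  -- T d. This replaces the square root of the usual L² estimate.
  have h1 : runningMax X n + c⁻¹ • ((2 : ℝ) • d) ≤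
      (c / 2) • e + c⁻¹ • b + (2 / c) • s := he.le_of_char fun ω => by
    simp only [map_add, map_smul, smul_eq_mul, ω.map_unit, hb ω, hd ω, hs ω, ω.map_abs]
    set x := ω (runningMax X n)
    set y := ω (∑ i ∈ Finset.range n, X i)
    have : 0 ≤ (c / 2 + c⁻¹ * x ^ 2 + 2 / c * y ^ 2) - (x + c⁻¹ * (2 * (x * |y|))) := by
      have h2 : (c / 2 + c⁻¹ * x ^ 2 + 2 / c * y ^ 2) - (x + c⁻¹ * (2 * (x * |y|))) =
          ((c - x) ^ 2 / 2 + (x - 2 * |y|) ^ 2 / 2) / c := by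
        rw [← sq_abs y]
        field_simp
        ring
      rw [h2]
      positivity
    linarith
  have h2 := h.T_mono h1
  simp only [map_add, map_smul, h.T_unit] at h2
  have h3 := smul_le_smul_of_nonneg_left (h.T_sq_runningMax_le he hA n hb hd) (inv_nonneg.2 hc.le)
  have h4 := smul_le_smul_of_nonneg_left (h.T_sq_sum_le he hA hw n hs) (div_nonneg zero_le_two hc.le)
  have h5 : T (runningMax X n) + c⁻¹ • T b ≤ (c / 2) • e + c⁻¹ • T b + (2 / c) • T s :=
    (add_le_add_right h3 _).trans h2
  have h6 : T (runningMax X n) ≤ (c / 2) • e + (2 / c) • T s := by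
    rw [add_right_comm] at h5
    exact le_of_add_le_add_right h5
  exact h6.trans (add_le_add_right h4 _)

end IsBoundedMartingaleDifference

end MaximalInequality

/-! ### Powers evaluated at characters. -/

section Power

variable {A : Type*} [Lattice A] [AddCommGroup A] [IsOrderedAddMonoid A]
  [Module ℝ A] [IsOrderedModule ℝ A] {e : A}

/-- For t < ω x and n large, the lower sum at t has value exactly t ^ p at ω; let t increase to ω x.
Such t never exceed M. -/
lemma rpow_char_le {x z : A} (hx : 0 ≤ x) {p M : ℝ} (hp : 0 < p) (hxM : x ≤ M • e)
    (hz : ∀ t : ℝ, 0 ≤ t → t ≤ M → ∀ n : ℕ, t ^ p • (e ⊓ (n : ℝ) • ((x - t • e) ⊔ 0)) ≤ z)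
    (ω : UnitChar e) : ω x ^ p ≤ ω z := by
  have hωM : ω x ≤ M := by simpa [ω.map_unit] using ω.mono hxM
  have hω0 : 0 ≤ ω x := by simpa using ω.mono hx
  have h : ∀ t : ℝ, 0 ≤ t → t ≤ M → ∀ n : ℕ,
      t ^ p * min 1 ((n : ℝ) * max (ω x - t) 0) ≤ ω z := fun t h0 hM n => by
    have h1 := ω.mono (hz t h0 hM n)
    simpa only [map_smul, smul_eq_mul, ω.map_inf, ω.map_unit, ω.map_sup, map_sub, map_zero,
      mul_one] using h1
  rcases hω0.eq_or_lt with h0 | h0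
  · have := h 0 le_rfl (hω0.trans hωM) 0
    rw [← h0, Real.zero_rpow hp.ne']
    simpa [Real.zero_rpow hp.ne'] using this
  · have hlt : ∀ t ∈ Set.Ioo 0 (ω x), t ^ p ≤ ω z := fun t ht => by
      obtain ⟨n, hn⟩ := exists_nat_gt (1 / (ω x - t))
      have hpos := sub_pos.2 ht.2
      have h1 := h t ht.1.le (ht.2.le.trans hωM) n
      rw [max_eq_left hpos.le, min_eq_left ((div_lt_iff₀ hpos).1 hn).le, mul_one] at h1
      exact h1
    have hcont : Filter.Tendsto (fun t : ℝ => t ^ p) (nhdsWithin (ω x) (Set.Iio (ω x)))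
        (nhds (ω x ^ p)) :=
      (Real.continuousAt_rpow_const _ _ (Or.inr hp.le)).tendsto.mono_left nhdsWithin_le_nhds
    exact le_of_tendsto hcont (Filter.mem_of_superset (Ioo_mem_nhdsLT h0) hlt)

end Power

/-! ### The order ideal of e as a vector lattice. -/

section UnitIdeal

variable {E : Type*} [Lattice E] [AddCommGroup E] [IsOrderedAddMonoid E]
  [Module ℝ E] [IsOrderedModule ℝ E]

/-- The order ideal generated by `e`. -/
def unitIdeal (e : E) : Submodule ℝ E where
  carrier := {x | ∃ c : ℝ, |x| ≤ c • e}
  zero_mem' := ⟨0, by simp⟩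
  add_mem' := by
    rintro x y ⟨c, hc⟩ ⟨d, hd⟩
    exact ⟨c + d, (abs_add_le x y).trans (add_smul c d e ▸ add_le_add hc hd)⟩
  smul_mem' := by
    rintro r x ⟨c, hc⟩
    refine ⟨|r| * c, ?_⟩
    have h : |r • x| = |r| • |x| := by
      rcases le_total 0 r with hr | hr
      · rw [abs_smul_of_nonneg hr, abs_of_nonneg hr]
      · rw [abs_of_nonpos hr, ← abs_smul_of_nonneg (neg_nonneg.2 hr), neg_smul, abs_neg]
    rw [h, mul_smul]
    exact smul_le_smul_of_nonneg_left hc (abs_nonneg r)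

lemma mem_unitIdeal_of_nonneg {e x : E} {c : ℝ} (h0 : 0 ≤ x) (h : x ≤ c • e) :
    x ∈ unitIdeal e := ⟨c, by rwa [abs_of_nonneg h0]⟩

lemma sup_mem_unitIdeal {e : E} ⦃x y : E⦄ (hx : x ∈ unitIdeal e) (hy : y ∈ unitIdeal e) :
    x ⊔ y ∈ unitIdeal e := by
  obtain ⟨c, hc⟩ := hx
  obtain ⟨d, hd⟩ := hy
  have h1 : |x ⊔ y| ≤ |x| + |y| := abs_le'.2
    ⟨sup_le ((le_abs_self x).trans (le_add_of_nonneg_right (abs_nonneg y)))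
      ((le_abs_self y).trans (le_add_of_nonneg_left (abs_nonneg x))),
     (neg_le_neg le_sup_left).trans
      ((neg_le_abs x).trans (le_add_of_nonneg_right (abs_nonneg y)))⟩
  exact ⟨c + d, h1.trans (add_smul c d e ▸ add_le_add hc hd)⟩

lemma inf_mem_unitIdeal {e : E} ⦃x y : E⦄ (hx : x ∈ unitIdeal e) (hy : y ∈ unitIdeal e) :
    x ⊓ y ∈ unitIdeal e := by
  have h : x ⊓ y = x + y - x ⊔ y := eq_sub_of_add_eq (inf_add_sup x y)
  rw [h]
  exact sub_mem (add_mem hx hy) (sup_mem_unitIdeal hx hy)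

instance (e : E) : Lattice (unitIdeal e) :=
  Subtype.lattice sup_mem_unitIdeal inf_mem_unitIdeal

instance (e : E) : IsOrderedAddMonoid (unitIdeal e) where
  add_le_add_left _ _ h c := add_le_add_left (α := E) h c

instance (e : E) : IsOrderedModule ℝ (unitIdeal e) where
  smul_le_smul_of_nonneg_left _ hc _ _ h := smul_le_smul_of_nonneg_left (β := E) h hc
  smul_le_smul_of_nonneg_right _ hx _ _ h := smul_le_smul_of_nonneg_right (β := E) h hx

lemma coe_sup_unitIdeal {e : E} (x y : unitIdeal e) : ((x ⊔ y : unitIdeal e) : E) = ↑x ⊔ ↑y := rfl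

lemma coe_abs_unitIdeal {e : E} (x : unitIdeal e) : ((|x| : unitIdeal e) : E) = |(x : E)| := rfl

lemma self_mem_unitIdeal {e : E} (he : 0 ≤ e) : e ∈ unitIdeal e :=
  mem_unitIdeal_of_nonneg (c := 1) he (by simp)

lemma mem_unitIdeal_of_abs_le {e x y : E} (hy : y ∈ unitIdeal e) (h : |x| ≤ y) :
    x ∈ unitIdeal e :=
  hy.imp fun _ hc => h.trans ((le_abs_self y).trans hc)

lemma coe_runningMax {e : E} (X : ℕ → unitIdeal e) (n : ℕ) :
    ((runningMax X n : unitIdeal e) : E) = runningMax (fun i => (X i : E)) n := by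
  induction n with
  | zero => rfl
  | succ n ih =>
    rw [runningMax, runningMax, coe_sup_unitIdeal, ih, coe_abs_unitIdeal,
      AddSubmonoidClass.coe_finsetSum]

end UnitIdeal

/-! ### Archimedean property and weak units under Dedekind completeness. -/

section DedekindComplete

variable {E : Type*} [ConditionallyCompleteLattice E] [AddCommGroup E] [IsOrderedAddMonoid E]
  [Module ℝ E] [IsOrderedModule ℝ E]

lemma isLUB_ciSup_of_le {I : Type*} [Nonempty I] {f : I → E} {b : E} (h : ∀ i, f i ≤ b) :
    IsLUB (Set.range f) (⨆ i, f i) :=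
  isLUB_ciSup ⟨b, by rintro _ ⟨i, rfl⟩; exact h i⟩

/-- The supremum s of the multiples of x satisfies s + x ≤ s. -/
lemma nonpos_of_nsmul_le {x y : E} (h : ∀ n : ℕ, (n : ℝ) • x ≤ y) : x ≤ 0 := by
  have hs := isLUB_ciSup_of_le h
  set s := ⨆ n : ℕ, (n : ℝ) • x
  have : s ≤ s - x := hs.2 (by
    rintro _ ⟨n, rfl⟩
    have := hs.1 ⟨n + 1, rfl⟩
    simp only [Nat.cast_add, Nat.cast_one, add_smul, one_smul] at this
    exact le_sub_iff_add_le.2 this)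
  simpa using this

lemma nonpos_of_forall_le_smul {x y : E} (h : ∀ ε : ℝ, 0 < ε → x ≤ ε • y) : x ≤ 0 := by
  refine nonpos_of_nsmul_le (y := y ⊔ 0) fun n => ?_
  rcases n.eq_zero_or_pos with rfl | hn
  · simp
  · have hn' : (0 : ℝ) < n := Nat.cast_pos.2 hn
    have := smul_le_smul_of_nonneg_left (h (n : ℝ)⁻¹ (inv_pos.2 hn')) hn'.le
    rw [smul_smul, mul_inv_cancel₀ hn'.ne', one_smul] at this
    exact this.trans le_sup_left

lemma le_of_forall_le_add_smul {x y z : E} (h : ∀ ε : ℝ, 0 < ε → x ≤ y + ε • z) : x ≤ y :=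
  sub_nonpos.1 (nonpos_of_forall_le_smul (y := z) fun ε hε => sub_le_iff_le_add'.2 (h ε hε))

/-- A positive element is the supremum of its truncations at the multiples of a weak unit. -/
lemma IsWeakOrderUnit.le_of_forall_inf_le {e x b : E} (he : IsWeakOrderUnit e)
    (h : ∀ m : ℕ, x ⊓ (m : ℝ) • e ≤ b) : x ≤ b := by
  have hs := isLUB_ciSup_of_le (f := fun m : ℕ => x ⊓ (m : ℝ) • e) (fun _ => inf_le_left)
  set s := ⨆ m : ℕ, x ⊓ (m : ℝ) • e
  have hsx : s ≤ x := hs.2 (by rintro _ ⟨m, rfl⟩; exact inf_le_left)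
  -- Adding e ⊓ (x - s) to the m-th truncation stays below the next one, so s absorbs it and x - s
  -- is disjoint from e.
  have h1 : s ≤ s - e ⊓ (x - s) := hs.2 (by
    rintro _ ⟨m, rfl⟩
    refine le_sub_iff_add_le.2 ((le_inf ?_ ?_).trans (hs.1 ⟨m + 1, rfl⟩))
    · calc x ⊓ (m : ℝ) • e + e ⊓ (x - s) ≤ s + (x - s) :=
          add_le_add (hs.1 ⟨m, rfl⟩) inf_le_right
        _ = x := by abel
    · rw [Nat.cast_add, Nat.cast_one, add_smul, one_smul]
      exact add_le_add inf_le_right inf_le_left)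
  have h2 : e ⊓ (x - s) = 0 :=
    le_antisymm (by simpa using h1) (le_inf he.1 (sub_nonneg.2 hsx))
  have h3 := he.2 (x - s) (by rwa [abs_of_nonneg (sub_nonneg.2 hsx)])
  rw [sub_eq_zero.1 h3]
  exact hs.2 (by rintro _ ⟨m, rfl⟩; exact h m)

lemma isStrongUnit_unitIdeal {e : E} (he : 0 ≤ e) :
    IsStrongUnit (⟨e, self_mem_unitIdeal he⟩ : unitIdeal e) where
  nonneg := he
  bound x := x.2.imp fun _ hc => (le_abs_self (x : E)).trans hc
  arch _ h := nonpos_of_forall_le_smul (E := E) (y := e) h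

lemma hasSups_unitIdeal (e : E) : HasSups (unitIdeal e) := by
  rintro S ⟨x₀, hx₀⟩ ⟨b, hb⟩
  have hs : IsLUB (Subtype.val '' S) (sSup (Subtype.val '' S)) :=
    isLUB_csSup ⟨_, x₀, hx₀, rfl⟩ ⟨b, by rintro _ ⟨x, hx, rfl⟩; exact hb hx⟩
  set s := sSup (Subtype.val '' S)
  have h1 : (x₀ : E) ≤ s := hs.1 ⟨x₀, hx₀, rfl⟩
  have h2 : s ≤ b := hs.2 (by rintro _ ⟨x, hx, rfl⟩; exact hb hx)
  have hmem : s ∈ unitIdeal e := by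
    have h : s - x₀ ∈ unitIdeal e := mem_unitIdeal_of_abs_le (b - x₀).2 (by
      rw [abs_of_nonneg (sub_nonneg.2 h1)]
      exact sub_le_sub_right h2 _)
    simpa using add_mem h x₀.2
  refine ⟨⟨s, hmem⟩, fun x hx => hs.1 ⟨x, hx, rfl⟩, fun y hy => hs.2 ?_⟩
  rintro _ ⟨x, hx, rfl⟩
  exact hy hx

end DedekindComplete

/-! ### Truncation at the unit and its control by p-th powers. -/

section Truncation

variable {E : Type*} [ConditionallyCompleteLattice E] [AddCommGroup E] [IsOrderedAddMonoid E]
  [Module ℝ E] [IsOrderedModule ℝ E]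

/-- The truncation of `y` to the order interval `[-e, e]`. -/
def truncate (e y : E) : E := (y ⊓ e) ⊔ -e

lemma abs_truncate_le {e : E} (he : 0 ≤ e) (y : E) : |truncate e y| ≤ |y| ⊓ e := by
  have hne : -e ≤ 0 := neg_nonpos.2 he
  refine abs_le'.2 ⟨sup_le (inf_le_inf_right _ (le_abs_self y)) ?_, ?_⟩
  · exact hne.trans (le_inf (abs_nonneg y) he)
  · rw [truncate, neg_sup, neg_inf, neg_neg]
    refine le_inf (inf_le_left.trans (sup_le (neg_le_abs y) (hne.trans (abs_nonneg y)))) inf_le_right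

lemma abs_sub_truncate_le (e y : E) : |y - truncate e y| ≤ (|y| - e) ⊔ 0 := by
  refine abs_le'.2 ⟨?_, ?_⟩
  · have h : y - y ⊓ e = (y - e) ⊔ 0 := by
      rw [sub_inf, sub_self, sup_comm]
    calc y - truncate e y ≤ y - y ⊓ e := sub_le_sub_left le_sup_left _
      _ = (y - e) ⊔ 0 := h
      _ ≤ _ := sup_le_sup_right (sub_le_sub_right (le_abs_self y) _) _
  · rw [neg_sub, truncate, sup_sub]
    refine sup_le ((sub_nonpos.2 inf_le_left).trans le_sup_right) (le_trans ?_ le_sup_left)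
    rw [← neg_add', add_comm, neg_add']
    exact sub_le_sub_right (neg_le_abs y) _

/-- `q` dominates the lower sums of the spectral integral for `|y| ^ p`. -/
def DominatesRpow (e : E) (p : ℝ) (y q : E) : Prop :=
  ∀ t : ℝ, 0 ≤ t → ∀ n : ℕ, t ^ p • (e ⊓ (n : ℝ) • ((|y| - t • e) ⊔ 0)) ≤ q

namespace DominatesRpow

variable {e : E} {p : ℝ} {y q : E}

lemma nonneg (h : DominatesRpow e p y q) (he : 0 ≤ e) : 0 ≤ q := by
  simpa [inf_eq_right.2 he] using h 0 le_rfl 0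

/-- Neither |y| nor q need lie in the ideal of e, so both are cut off, at matching heights M and M ^
p; lower sums with t ≤ M respect the second cut. -/
lemma rpow_char_le (h : DominatesRpow e p y q) (he : 0 ≤ e) (hp : 0 < p) {M : ℝ} (hM : 0 ≤ M)
    {x z : unitIdeal e} (hx : (x : E) = |y| ⊓ M • e) (hz : (z : E) = q ⊓ M ^ p • e)
    (ω : UnitChar (⟨e, self_mem_unitIdeal he⟩ : unitIdeal e)) : ω x ^ p ≤ ω z := by
  have hx0 : 0 ≤ (x : E) := hx ▸ le_inf (abs_nonneg y) (smul_nonneg hM he)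
  have hxM : (x : E) ≤ M • e := hx ▸ inf_le_right
  refine RieszSpace.rpow_char_le (x := x) hx0 hp hxM (fun t ht htM n => ?_) ω
  change t ^ p • (e ⊓ (n : ℝ) • (((x : E) - t • e) ⊔ 0)) ≤ (z : E)
  rw [hz]
  refine le_inf ((smul_le_smul_of_nonneg_left (inf_le_inf_left _
    (smul_le_smul_of_nonneg_left (sup_le_sup_right (sub_le_sub_right ?_ _) _)
      n.cast_nonneg)) (Real.rpow_nonneg ht p)).trans (h t ht n)) ?_
  · exact hx ▸ inf_le_left
  · exact (smul_le_smul_of_nonneg_left inf_le_left (Real.rpow_nonneg ht p)).trans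
      (smul_le_smul_of_nonneg_right (Real.rpow_le_rpow ht htM hp.le) he)

/-- This rests on s ≤ s ^ p + 1 for real s ≥ 0 and p ≥ 1, tested at characters on the truncations of
|y| at m e. -/
lemma abs_sub_truncate_le (h : DominatesRpow e p y q) (he : IsWeakOrderUnit e) (hp : 1 ≤ p) :
    |y - truncate e y| ≤ q := by
  refine (RieszSpace.abs_sub_truncate_le e y).trans (sup_le (sub_le_iff_le_add.2 ?_) (h.nonneg he.1))
  refine he.le_of_forall_inf_le fun m => ?_
  have hm : (0 : ℝ) ≤ m := m.cast_nonneg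
  let x : unitIdeal e := ⟨|y| ⊓ (m : ℝ) • e, mem_unitIdeal_of_nonneg
    (le_inf (abs_nonneg y) (smul_nonneg hm he.1)) inf_le_right⟩
  let z : unitIdeal e := ⟨q ⊓ (m : ℝ) ^ p • e, mem_unitIdeal_of_nonneg
    (le_inf (h.nonneg he.1) (smul_nonneg (Real.rpow_nonneg hm p) he.1)) inf_le_right⟩
  have h1 : x ≤ z + ⟨e, self_mem_unitIdeal he.1⟩ := (isStrongUnit_unitIdeal he.1).le_of_char
    fun ω => by
      have h2 := h.rpow_char_le he.1 (zero_lt_one.trans_le hp) hm (x := x) (z := z) rfl rfl ω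
      have h3 : 0 ≤ ω x := by
        have : 0 ≤ x := le_inf (abs_nonneg y) (smul_nonneg hm he.1)
        simpa using ω.mono this
      rw [map_add, ω.map_unit]
      rcases le_total (ω x) 1 with h4 | h4
      · linarith [Real.rpow_nonneg h3 p]
      · have := Real.rpow_le_rpow_of_exponent_le h4 hp
        rw [Real.rpow_one] at this
        linarith
  have h2 : |y| ⊓ (m : ℝ) • e ≤ q ⊓ (m : ℝ) ^ p • e + e := h1
  exact h2.trans (add_le_add_left inf_le_left _)

/-- On [0, 1] one has s² ≤ s ^ p; this is where p ≤ 2 enters. -/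
lemma sq_truncate_le (h : DominatesRpow e p y q) (he : 0 ≤ e) (hp : 1 ≤ p) (hp2 : p ≤ 2)
    {u z : unitIdeal e} (hu : (u : E) = truncate e y) (hz : (z : E) = q ⊓ e)
    (ω : UnitChar (⟨e, self_mem_unitIdeal he⟩ : unitIdeal e)) : ω u ^ 2 ≤ ω z := by
  let x : unitIdeal e := ⟨|y| ⊓ (1 : ℝ) • e, mem_unitIdeal_of_nonneg (c := 1)
    (le_inf (abs_nonneg y) (smul_nonneg zero_le_one he)) inf_le_right⟩
  have h1 := h.rpow_char_le he (zero_lt_one.trans_le hp) zero_le_one (x := x) (z := z) rfl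
    (by simpa using hz) ω
  have h2 : |u| ≤ x := by
    change |(u : E)| ≤ |y| ⊓ (1 : ℝ) • e
    rw [hu, one_smul]
    exact abs_truncate_le he y
  have h3 := ω.mono h2
  rw [ω.map_abs] at h3
  have h4 : ω x ≤ 1 := by
    have : x ≤ ⟨e, self_mem_unitIdeal he⟩ := by
      change |y| ⊓ (1 : ℝ) • e ≤ e
      rw [one_smul]
      exact inf_le_right
    simpa [ω.map_unit] using ω.mono this
  have h5 : 0 ≤ ω x := (abs_nonneg _).trans h3
  calc ω u ^ 2 = |ω u| ^ 2 := (sq_abs _).symm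
    _ ≤ ω x ^ 2 := pow_le_pow_left₀ (abs_nonneg _) h3 2
    _ = ω x ^ (2 : ℝ) := (Real.rpow_two _).symm
    _ ≤ ω x ^ p := Real.rpow_le_rpow_of_exponent_ge' h5 h4 (by linarith) hp2
    _ ≤ ω z := h1

end DominatesRpow

end Truncation

/-! ### Disjoint elements and a Markov inequality. -/

section Disjoint

variable {E : Type*} [Lattice E] [AddCommGroup E] [IsOrderedAddMonoid E]
  [Module ℝ E] [IsOrderedModule ℝ E]

lemma smul_inf_smul_eq_zero {x y : E} (hx : 0 ≤ x) (hy : 0 ≤ y) (h : x ⊓ y = 0) {a b : ℝ}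
    (ha : 0 ≤ a) (hb : 0 ≤ b) : a • x ⊓ b • y = 0 := by
  refine le_antisymm ?_ (le_inf (smul_nonneg ha hx) (smul_nonneg hb hy))
  calc a • x ⊓ b • y ≤ max a b • x ⊓ max a b • y :=
        inf_le_inf (smul_le_smul_of_nonneg_right (le_max_left _ _) hx)
          (smul_le_smul_of_nonneg_right (le_max_right _ _) hy)
    _ = 0 := by rw [← smul_inf_of_nonneg (ha.trans (le_max_left a b)), h, smul_zero]

lemma inf_eq_zero_of_le {x y x' y' : E} (hx : 0 ≤ x) (hy : 0 ≤ y) (hxx : x ≤ x') (hyy : y ≤ y')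
    (h : x' ⊓ y' = 0) : x ⊓ y = 0 :=
  le_antisymm (h ▸ inf_le_inf hxx hyy) (le_inf hx hy)

lemma add_eq_sup_of_inf_eq_zero {x y : E} (h : x ⊓ y = 0) : x + y = x ⊔ y := by
  rw [← inf_add_sup, h, zero_add]


/-- Markov's inequality before applying T: e ⊓ c (s - k e)⁺ lives where s exceeds k, hence is
disjoint from (k e - s)⁺. -/
lemma smul_inf_posPart_le {e s : E} (he : 0 ≤ e) (hs : 0 ≤ s) {k c : ℝ} (hk : 0 ≤ k)
    (hc : 0 ≤ c) : k • (e ⊓ c • ((s - k • e) ⊔ 0)) ≤ s := by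
  set y := (s - k • e) ⊔ 0
  set w := (k • e - s) ⊔ 0
  have hy : 0 ≤ y := le_sup_right
  have hw : 0 ≤ w := le_sup_right
  have hu : 0 ≤ e ⊓ c • y := le_inf he (smul_nonneg hc hy)
  have hyw : y ⊓ w = 0 := by
    have := posPart_inf_negPart_eq_zero (s - k • e)
    rwa [posPart_def, negPart_def, neg_sub] at this
  have h1 : (k • (e ⊓ c • y)) ⊓ w = 0 := by
    refine inf_eq_zero_of_le (smul_nonneg hk hu) hw (smul_le_smul_of_nonneg_left inf_le_right hk)
      le_rfl ?_
    rw [smul_smul]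
    simpa using smul_inf_smul_eq_zero hy hw hyw (mul_nonneg hk hc) zero_le_one
  have h2 : k • (e ⊓ c • y) + w ≤ k • e := by
    rw [add_eq_sup_of_inf_eq_zero h1]
    exact sup_le (smul_le_smul_of_nonneg_left inf_le_left hk)
      (sup_le (sub_le_self _ hs) (smul_nonneg hk he))
  calc k • (e ⊓ c • y) ≤ k • e - w := le_sub_iff_add_le.2 h2
    _ ≤ k • e - (k • e - s) := sub_le_sub_left le_sup_left _
    _ = s := by abel

/-- One layer of the layer-cake decomposition of s. -/
lemma inf_add_one_smul_le {e : E} (he : 0 ≤ e) (s : E) (K : ℝ) :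
    s ⊓ (K + 1) • e ≤ s ⊓ K • e + ((s - K • e) ⊔ 0) ⊓ e := by
  have h1 : s ⊓ K • e + ((s - K • e) ⊔ 0) = s := by
    have h : (s - K • e) ⊔ 0 = s - s ⊓ K • e := by rw [sub_inf, sub_self, sup_comm]
    rw [h]
    abel
  rw [add_inf, h1, inf_add, add_smul, one_smul]
  refine le_inf inf_le_left (le_inf (inf_le_left.trans (le_add_of_nonneg_right he)) inf_le_right)

end Disjoint

/-! ### Order continuity and fixed points of conditional expectations. -/

section ConditionalExpectation

variable {E : Type*} [ConditionallyCompleteLattice E] [AddCommGroup E] [IsOrderedAddMonoid E]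
  [Module ℝ E] [IsOrderedModule ℝ E] {T : E →ₗ[ℝ] E}

namespace IsConditionalExpectation

lemma mono (hT : IsConditionalExpectation T) : Monotone T := fun x y h => by
  have := hT.positive (y - x) (sub_nonneg.2 h)
  rwa [map_sub, sub_nonneg] at this

lemma isGLB_image (hT : IsConditionalExpectation T) {v : ℕ → E} (hv : Antitone v)
    (h : IsGLB (Set.range v) 0) : IsGLB (Set.range fun n => T (v n)) 0 := by
  have := hT.orderContinuous (Set.range v) (Set.range_nonempty v) (by
    rintro _ ⟨m, rfl⟩ _ ⟨n, rfl⟩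
    exact ⟨v (max m n), ⟨_, rfl⟩, hv (le_max_left _ _), hv (le_max_right _ _)⟩) h
  rwa [← Set.range_comp] at this

lemma isLUB_image (hT : IsConditionalExpectation T) {u : ℕ → E} (hu : Monotone u) {s : E}
    (h : IsLUB (Set.range u) s) : IsLUB (Set.range fun n => T (u n)) (T s) := by
  have h1 := hT.isGLB_image (v := fun n => s - u n) (fun m n hmn => sub_le_sub_left (hu hmn) _)
    ⟨by rintro _ ⟨n, rfl⟩; exact sub_nonneg.2 (h.1 ⟨n, rfl⟩), fun g hg => by
      have : s ≤ s - g := h.2 (by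
        rintro _ ⟨n, rfl⟩
        exact le_sub_comm.1 (hg ⟨n, rfl⟩))
      simpa using this⟩
  refine ⟨by rintro _ ⟨n, rfl⟩; exact hT.mono (h.1 ⟨n, rfl⟩), fun b hb => ?_⟩
  have : T s - b ≤ 0 := h1.2 (by
    rintro _ ⟨n, rfl⟩
    simp only [map_sub]
    exact sub_le_sub_left (hb ⟨n, rfl⟩) _)
  exact sub_nonpos.1 this

lemma abs_map_le (hT : IsConditionalExpectation T) (x : E) : |T x| ≤ T |x| :=
  abs_le'.2 ⟨hT.mono (le_abs_self x), by rw [← map_neg]; exact hT.mono (neg_le_abs x)⟩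

lemma map_of_mem_range (hT : IsConditionalExpectation T) {x : E} (hx : x ∈ Set.range T) :
    T x = x := by
  obtain ⟨y, rfl⟩ := hx
  exact hT.projection y

lemma map_sup_of_fixed (hT : IsConditionalExpectation T) {x y : E} (hx : T x = x) (hy : T y = y) :
    T (x ⊔ y) = x ⊔ y :=
  hT.map_of_mem_range (hT.sup_mem_range x ⟨x, hx⟩ y ⟨y, hy⟩)

end IsConditionalExpectation

lemma IsStrictlyPositive.nonpos (hpos : IsStrictlyPositive T) (hT : IsConditionalExpectation T)
    {x : E} (h : T (x ⊔ 0) ≤ 0) : x ≤ 0 := by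
  have h0 : T |x ⊔ 0| = 0 := by
    rw [abs_of_nonneg le_sup_right]
    exact le_antisymm h (hT.positive _ le_sup_right)
  exact le_sup_left.trans (hpos _ h0).le

end ConditionalExpectation

/-! ### Components of the unit generated by increasing sequences. -/

section Components

variable {E : Type*} [ConditionallyCompleteLattice E] [AddCommGroup E] [IsOrderedAddMonoid E]
  [Module ℝ E] [IsOrderedModule ℝ E] {e : E} {y : ℕ → E}

/-- The component of `e` in the band generated by an increasing sequence `y` of positive elements. -/
noncomputable def seqComponent (e : E) (y : ℕ → E) : E :=
  ⨆ n : ℕ, e ⊓ ((n : ℝ) + 1) • y n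

lemma isLUB_seqComponent (e : E) (y : ℕ → E) :
    IsLUB (Set.range fun n : ℕ => e ⊓ ((n : ℝ) + 1) • y n) (seqComponent e y) :=
  isLUB_ciSup_of_le fun _ => inf_le_left

lemma seqComponent_le (e : E) (y : ℕ → E) : seqComponent e y ≤ e :=
  (isLUB_seqComponent e y).2 (by rintro _ ⟨n, rfl⟩; exact inf_le_left)

lemma inf_smul_le_seqComponent (e : E) (y : ℕ → E) (n : ℕ) :
    e ⊓ ((n : ℝ) + 1) • y n ≤ seqComponent e y :=
  (isLUB_seqComponent e y).1 ⟨n, rfl⟩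

lemma seqComponent_nonneg (he : 0 ≤ e) (hy : ∀ n, 0 ≤ y n) : 0 ≤ seqComponent e y :=
  (le_inf he (smul_nonneg (by positivity) (hy 0))).trans (inf_smul_le_seqComponent e y 0)

lemma inf_le_seqComponent (hy : ∀ n, 0 ≤ y n) (n : ℕ) :
    y n ⊓ e ≤ seqComponent e y := by
  refine le_trans ?_ (inf_smul_le_seqComponent e y n)
  rw [inf_comm]
  refine inf_le_inf_left _ ?_
  rw [add_smul, one_smul]
  exact le_add_of_nonneg_left (smul_nonneg n.cast_nonneg (hy n))

lemma seqComponent_le_of_le {y' : ℕ → E} (h : ∀ n, y n ≤ y' n) :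
    seqComponent e y ≤ seqComponent e y' :=
  (isLUB_seqComponent e y).2 (by
    rintro _ ⟨n, rfl⟩
    exact (inf_le_inf_left _ (smul_le_smul_of_nonneg_left (h n) (by positivity))).trans
      (inf_smul_le_seqComponent e y' n))

lemma monotone_inf_smul (hy : ∀ n, 0 ≤ y n) (hmono : Monotone y) :
    Monotone fun n : ℕ => e ⊓ ((n : ℝ) + 1) • y n := fun m n h =>
  inf_le_inf_left _ ((smul_le_smul_of_nonneg_left (hmono h) (by positivity)).trans
    (smul_le_smul_of_nonneg_right (by gcongr) (hy n)))

/-- Let u_n be the n-th approximant and d the meet to be shown zero. Then u_n + d ⊓ u_n is below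
both e and 2 (n + 1) y_n, hence below u_{2n+1}. The supremum p therefore absorbs d ⊓ u_j, so d is
disjoint from every u_j; then p absorbs d too. -/
lemma seqComponent_inf_sub (he : 0 ≤ e) (hy : ∀ n, 0 ≤ y n) (hmono : Monotone y) :
    seqComponent e y ⊓ (e - seqComponent e y) = 0 := by
  set p := seqComponent e y
  set d := p ⊓ (e - p)
  have hm := monotone_inf_smul (e := e) hy hmono
  set u : ℕ → E := fun n => e ⊓ ((n : ℝ) + 1) • y n
  have hup : ∀ n, u n ≤ p := inf_smul_le_seqComponent e y
  have h1 : ∀ n, u n + d ⊓ u n ≤ p := fun n => by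
    refine le_trans (le_inf ?_ ?_) (hup (2 * n + 1))
    · calc u n + d ⊓ u n ≤ p + (e - p) := add_le_add (hup n) (inf_le_left.trans inf_le_right)
        _ = e := by abel
    · calc u n + d ⊓ u n ≤ ((n : ℝ) + 1) • y n + ((n : ℝ) + 1) • y n :=
          add_le_add inf_le_right (inf_le_right.trans inf_le_right)
        _ = (((2 * n + 1 : ℕ) : ℝ) + 1) • y n := by
          rw [← add_smul]
          congr 1
          push_cast
          ring
        _ ≤ _ := smul_le_smul_of_nonneg_left (hmono (by omega)) (by positivity)
  have h2 : ∀ j, d ⊓ u j ≤ 0 := fun j => by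
    have : p ≤ p - d ⊓ u j := (isLUB_seqComponent e y).2 (by
      rintro _ ⟨n, rfl⟩
      refine le_sub_iff_add_le.2 (le_trans ?_ (h1 (max n j)))
      exact add_le_add (hm (le_max_left _ _)) (inf_le_inf_left _ (hm (le_max_right _ _))))
    simpa using this
  have hp0 : 0 ≤ p := seqComponent_nonneg he hy
  have hd0 : 0 ≤ d := le_inf hp0 (sub_nonneg.2 (seqComponent_le e y))
  have h3 : p ≤ p - d := (isLUB_seqComponent e y).2 (by
    rintro _ ⟨n, rfl⟩
    have hu0 : 0 ≤ u n := le_inf he (smul_nonneg (by positivity) (hy n))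
    refine le_sub_iff_add_le.2 ?_
    have h := add_eq_sup_of_inf_eq_zero (le_antisymm (h2 n) (le_inf hd0 hu0))
    rw [add_comm]
    exact h.le.trans (sup_le inf_le_left (hup n)))
  exact le_antisymm (by simpa using h3) hd0

end Components

/-! ### Boundedness of T-bounded increasing sequences. -/

section UniversalCompletion

variable {E U : Type*} [ConditionallyCompleteLattice E] [AddCommGroup E] [IsOrderedAddMonoid E]
  [Module ℝ E] [IsOrderedModule ℝ E]
  [ConditionallyCompleteLattice U] [AddCommGroup U] [IsOrderedAddMonoid U]
  [Module ℝ U] [IsOrderedModule ℝ U] {ι : E →ₗ[ℝ] U}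

namespace IsUniversalCompletion

lemma le_iff (hι : IsUniversalCompletion ι) {x y : E} : ι x ≤ ι y ↔ x ≤ y := by
  rw [← sup_eq_right, ← hι.map_sup, hι.injective.eq_iff, sup_eq_right]

lemma map_inf (hι : IsUniversalCompletion ι) (x y : E) : ι (x ⊓ y) = ι x ⊓ ι y := by
  have h := congrArg ι (inf_add_sup x y)
  rw [map_add, map_add, hι.map_sup, ← inf_add_sup (ι x)] at h
  exact add_right_cancel h

lemma map_abs (hι : IsUniversalCompletion ι) (x : E) : ι |x| = |ι x| := by
  rw [abs, hι.map_sup, map_neg]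
  rfl

lemma exists_pos_le (hι : IsUniversalCompletion ι) {u : U} (hu : ¬ u ≤ 0) :
    ∃ x : E, 0 < x ∧ ι x ≤ u ⊔ 0 := by
  obtain ⟨x, hx, hxu⟩ := hι.orderDense (u ⊔ 0)
    (lt_of_le_of_ne le_sup_right fun h => hu (le_sup_left.trans h.ge))
  rw [← map_zero ι, lt_iff_le_not_ge, hι.le_iff, hι.le_iff, ← lt_iff_le_not_ge] at hx
  exact ⟨x, hx, hxu⟩

/-- By order density, a lower bound in U with nonzero positive part would dominate a nonzero
positive element of E. -/
lemma isGLB_image (hι : IsUniversalCompletion ι) {v : ℕ → E} (h : IsGLB (Set.range v) 0) :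
    IsGLB (Set.range fun n => ι (v n)) 0 := by
  have h0 : ∀ n, 0 ≤ v n := fun n => h.1 ⟨n, rfl⟩
  refine ⟨?_, fun u hu => ?_⟩
  · rintro _ ⟨n, rfl⟩
    rw [← map_zero ι, hι.le_iff]
    exact h0 n
  · by_contra hu0
    obtain ⟨x, hx, hxu⟩ := hι.exists_pos_le hu0
    refine hx.not_ge (h.2 ?_)
    rintro _ ⟨n, rfl⟩
    refine hι.le_iff.1 (hxu.trans (sup_le (hu ⟨n, rfl⟩) ?_))
    rw [← map_zero ι, hι.le_iff]
    exact h0 n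

lemma isWeakOrderUnit_map (hι : IsUniversalCompletion ι) {e : E} (he : IsWeakOrderUnit e) :
    IsWeakOrderUnit (ι e) := by
  refine ⟨by rw [← map_zero ι, hι.le_iff]; exact he.1, fun u hu => ?_⟩
  by_contra hne
  have h0 : ¬ |u| ≤ 0 := fun h => hne (le_antisymm ((le_abs_self u).trans h)
    (neg_nonpos.1 ((neg_le_abs u).trans h)))
  obtain ⟨x, hx, hxu⟩ := hι.exists_pos_le h0
  rw [sup_eq_left.2 (abs_nonneg u)] at hxu
  have h1 : ι (e ⊓ x) ≤ ι 0 := by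
    rw [hι.map_inf, map_zero, ← hu]
    exact inf_le_inf_left _ hxu
  refine hx.ne' (he.2 x ?_)
  rw [abs_of_nonneg hx.le]
  exact le_antisymm (hι.le_iff.1 h1) (le_inf he.1 hx.le)

/-- The layers `∑ p k` of a sequence of components decreasing to zero are bounded in the
universal completion. -/
lemma exists_bound_sum_components (hι : IsUniversalCompletion ι) {e : E} {p : ℕ → E}
    (hp : Antitone p) (hpe : ∀ k, p k ≤ e) (hp0 : IsGLB (Set.range p) 0)
    (hcomp : ∀ k, p k ⊓ (e - p k) = 0) :
    ∃ b : U, ∀ K, ι (∑ k ∈ Finset.range K, p k) ≤ b := by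
  have hp_nonneg : ∀ k, 0 ≤ p k := fun k => hp0.1 ⟨k, rfl⟩
  set c : ℕ → E := fun k => p k - p (k + 1) with hcdef
  have hc : ∀ k, 0 ≤ c k := fun k => sub_nonneg.2 (hp k.le_succ)
  have hcp : ∀ k, c k ≤ p k := fun k => sub_le_self _ (hp_nonneg _)
  have hdisj : ∀ j k, j < k → c j ⊓ c k = 0 := fun j k hjk =>
    inf_comm (c j) (c k) ▸ inf_eq_zero_of_le (hc k) (hc j) ((hcp k).trans (hp hjk))
      (sub_le_sub_right (hpe j) _) (hcomp (j + 1))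
  have hscaled : ∀ j k : ℕ, j ≠ k → (((j : ℝ) + 1) • c j) ⊓ (((k : ℝ) + 1) • c k) = 0 := by
    intro j k hjk
    refine smul_inf_smul_eq_zero (hc j) (hc k) ?_ (by positivity) (by positivity)
    rcases hjk.lt_or_gt with h | h
    · exact hdisj j k h
    · rw [inf_comm]
      exact hdisj k j h
  -- The slices c k = p k - p (k + 1) are pairwise disjoint, and the whole sum of layers takes the
  -- value k + 1 on c k; b is thus the expected total.
  obtain ⟨b, hb⟩ := hι.laterallyComplete (Set.range fun k : ℕ => ι (((k : ℝ) + 1) • c k))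
    (Set.range_nonempty _)
    (by
      rintro _ ⟨k, rfl⟩
      rw [← map_zero ι, hι.le_iff]
      exact smul_nonneg (by positivity) (hc k))
    (by
      rintro _ ⟨j, rfl⟩ _ ⟨k, rfl⟩ hne
      have hjk : j ≠ k := by
        rintro rfl
        exact hne rfl
      simp only
      rw [← hι.map_inf, hscaled j k hjk, map_zero])
  have hb0 : 0 ≤ b := le_trans (by
    rw [← map_zero ι, hι.le_iff]
    exact smul_nonneg (by positivity) (hc 0)) (hb.1 ⟨0, rfl⟩)
  set S : ℕ → E := fun j => ∑ k ∈ Finset.range j, ((k : ℝ) + 1) • c k with hSdef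
  have hS0 : ∀ j, 0 ≤ S j := fun j =>
    Finset.sum_nonneg fun k _ => smul_nonneg (by positivity) (hc k)
  have hSle : ∀ j : ℕ, S j ≤ (j : ℝ) • (e - p j) := by
    intro j
    have h1 : S j ≤ ∑ k ∈ Finset.range j, (j : ℝ) • c k := Finset.sum_le_sum fun k hk =>
      smul_le_smul_of_nonneg_right (by exact_mod_cast Finset.mem_range.1 hk) (hc k)
    refine h1.trans ?_
    rw [← Finset.smul_sum, Finset.sum_range_sub']
    exact smul_le_smul_of_nonneg_left (sub_le_sub_right (hpe 0) _) j.cast_nonneg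
  have hSb : ∀ j, ι (S j) ≤ b := by
    intro j
    induction j with
    | zero => simpa [S] using hb0
    | succ j ih =>
      have hd : S j ⊓ ((j : ℝ) + 1) • c j = 0 := by
        refine inf_eq_zero_of_le (hS0 j) (smul_nonneg (by positivity) (hc j)) (hSle j)
          (smul_le_smul_of_nonneg_left (hcp j) (by positivity)) ?_
        rw [inf_comm]
        exact smul_inf_smul_eq_zero (hp_nonneg j) (sub_nonneg.2 (hpe j)) (hcomp j)
          (by positivity) (by positivity)
      have : S (j + 1) = S j ⊔ ((j : ℝ) + 1) • c j := by
        rw [← add_eq_sup_of_inf_eq_zero hd]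
        exact Finset.sum_range_succ _ _
      rw [this, hι.map_sup]
      exact sup_le ih (hb.1 ⟨j, rfl⟩)
  have hbase : ∀ K : ℕ, ∑ k ∈ Finset.range K, p k = S K + (K : ℝ) • p K := by
    intro K
    induction K with
    | zero => simp [S]
    | succ K ih =>
      rw [Finset.sum_range_succ, ih, hSdef]
      simp only [Finset.sum_range_succ, hcdef, smul_sub, Nat.cast_add, Nat.cast_one, add_smul,
        one_smul]
      abel
  -- Slicing further only enlarges the bound, so the remainder K p K is traded for K p j with j as
  -- large as desired, and p j decreases to 0.
  have hstep : ∀ K j : ℕ, K ≤ j → ∑ k ∈ Finset.range K, p k ≤ S j + (K : ℝ) • p j := by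
    intro K j hKj
    induction j, hKj using Nat.le_induction with
    | base => exact (hbase K).le
    | succ j hKj ih =>
      refine ih.trans ?_
      have h1 : S (j + 1) = S j + ((j : ℝ) + 1) • c j := Finset.sum_range_succ _ _
      have h2 : (K : ℝ) • c j ≤ ((j : ℝ) + 1) • c j :=
        smul_le_smul_of_nonneg_right (by
          have : (K : ℝ) ≤ j := by exact_mod_cast hKj
          linarith) (hc j)
      have h3 : p j = c j + p (j + 1) := by simp [hcdef]
      rw [h1, h3, smul_add, add_assoc]
      exact add_le_add_right (add_le_add_left h2 _) _
  refine ⟨b, fun K => ?_⟩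
  have hK : (0 : ℝ) < (K : ℝ) + 1 := by positivity
  have hall : ∀ j, ι (∑ k ∈ Finset.range K, p k) - b ≤ ((K : ℝ) + 1) • ι (p j) := by
    intro j
    rw [sub_le_iff_le_add']
    calc ι (∑ k ∈ Finset.range K, p k) ≤ ι (S (max K j) + (K : ℝ) • p (max K j)) :=
          hι.le_iff.2 (hstep K _ (le_max_left _ _))
      _ ≤ ι (S (max K j) + ((K : ℝ) + 1) • p j) := by
          refine hι.le_iff.2 (add_le_add_right ?_ _)
          exact (smul_le_smul_of_nonneg_left (hp (le_max_right K j)) K.cast_nonneg).trans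
            (smul_le_smul_of_nonneg_right (by linarith) (hp_nonneg j))
      _ ≤ b + ((K : ℝ) + 1) • ι (p j) := by
          rw [map_add, map_smul]
          exact add_le_add_left (hSb _) _
  have h0 : ((K : ℝ) + 1)⁻¹ • (ι (∑ k ∈ Finset.range K, p k) - b) ≤ 0 :=
    (hι.isGLB_image hp0).2 (by
      rintro _ ⟨j, rfl⟩
      have := smul_le_smul_of_nonneg_left (hall j) (inv_nonneg.2 hK.le)
      rwa [smul_smul, inv_mul_cancel₀ hK.ne', one_smul] at this)
  have h1 := smul_le_smul_of_nonneg_left h0 hK.le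
  rw [smul_smul, mul_inv_cancel₀ hK.ne', one_smul, smul_zero] at h1
  exact sub_nonpos.1 h1

end IsUniversalCompletion

/-- On its natural domain, a strictly positive conditional expectation detects the boundedness of
increasing sequences of positive elements. -/
theorem exists_bound_of_map_le (hι : IsUniversalCompletion ι) {e : E} (he : IsWeakOrderUnit e)
    {T : E →ₗ[ℝ] E} (hT : IsConditionalExpectation T) (hpos : IsStrictlyPositive T)
    (hL1 : naturalDomain ι T = Set.range ι) {s : ℕ → E} (hs : Monotone s) (hs0 : ∀ n, 0 ≤ s n)
    {B : E} (hB : ∀ n, T (s n) ≤ B) : ∃ b, ∀ n, s n ≤ b := by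
  set y : ℕ → ℕ → E := fun k n => (s n - (k : ℝ) • e) ⊔ 0 with hy
  have hy0 : ∀ k n, 0 ≤ y k n := fun k n => le_sup_right
  have hymono : ∀ k, Monotone (y k) := fun k m n h => sup_le_sup_right (sub_le_sub_right (hs h) _) _
  set p : ℕ → E := fun k => seqComponent e (y k) with hpdef
  have hp : Antitone p := fun j k hjk => seqComponent_le_of_le fun n =>
    sup_le_sup_right (sub_le_sub_left
      (smul_le_smul_of_nonneg_right (Nat.cast_le.2 hjk) he.1) _) _
  -- Markov's inequality: T (p k) ≤ B / k. With strict positivity this makes p k decrease to 0.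
  have hTp : ∀ k : ℕ, (k : ℝ) • T (p k) ≤ B := by
    intro k
    rcases k.eq_zero_or_pos with rfl | hk
    · have : 0 ≤ B := (hT.positive _ (hs0 0)).trans (hB 0)
      simpa using this
    have hk' : (0 : ℝ) < k := Nat.cast_pos.2 hk
    have h1 := (hT.isLUB_image (monotone_inf_smul (e := e) (hy0 k) (hymono k))
      (isLUB_seqComponent e (y k))).2 (show (k : ℝ)⁻¹ • B ∈ _ by
        rintro _ ⟨n, rfl⟩
        have h2 := (hT.mono (smul_inf_posPart_le he.1 (hs0 n) hk'.le
          (c := (n : ℝ) + 1) (by positivity))).trans (hB n)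
        rw [map_smul] at h2
        have h3 := smul_le_smul_of_nonneg_left h2 (inv_nonneg.2 hk'.le)
        rwa [smul_smul, inv_mul_cancel₀ hk'.ne', one_smul] at h3)
    have h3 := smul_le_smul_of_nonneg_left h1 hk'.le
    rwa [smul_smul, mul_inv_cancel₀ hk'.ne', one_smul] at h3
  have hp0 : IsGLB (Set.range p) 0 := by
    refine ⟨?_, fun g hg => hpos.nonpos hT (nonpos_of_nsmul_le (y := B) fun k => ?_)⟩
    · rintro _ ⟨k, rfl⟩
      exact seqComponent_nonneg he.1 (hy0 k)
    · refine le_trans (smul_le_smul_of_nonneg_left (hT.mono (sup_le (hg ⟨k, rfl⟩) ?_))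
        k.cast_nonneg) (hTp k)
      exact seqComponent_nonneg he.1 (hy0 k)
  obtain ⟨b, hb⟩ := hι.exists_bound_sum_components hp (fun k => seqComponent_le e (y k)) hp0
    fun k => seqComponent_inf_sub he.1 (hy0 k) (hymono k)
  have htrunc : ∀ n K : ℕ, s n ⊓ (K : ℝ) • e ≤ ∑ k ∈ Finset.range K, p k := by
    intro n K
    induction K with
    | zero => simp
    | succ K ih =>
      rw [Finset.sum_range_succ, Nat.cast_add, Nat.cast_one]
      exact (inf_add_one_smul_le he.1 (s n) K).trans (add_le_add ih (inf_le_seqComponent (hy0 K) n))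
  have hsb : ∀ n, ι (s n) ≤ b := fun n => by
    refine (hι.isWeakOrderUnit_map he).le_of_forall_inf_le fun K => ?_
    rw [← map_smul, ← hι.map_inf]
    exact (hι.le_iff.2 (htrunc n K)).trans (hb K)
  have hlub := isLUB_ciSup_of_le hsb
  set f := ⨆ n, ι (s n)
  have hι0 : (0 : U) ≤ ι (s 0) := by
    rw [← map_zero ι, hι.le_iff]
    exact hs0 0
  -- The supremum f, so far only in U, is in dom T as witnessed by the sequence s itself; E = L¹(T)
  -- then puts it in E.
  have hf : f ∈ naturalDomain ι T := by
    refine ⟨f, 0, ⟨hι0.trans (hlub.1 ⟨0, rfl⟩), Set.range s, Set.range_nonempty s, ?_, ?_, ?_, ?_⟩,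
      ⟨le_rfl, {0}, Set.singleton_nonempty _, ?_, ?_, ?_, ?_⟩, (sub_zero f).symm⟩
    · rintro _ ⟨m, rfl⟩ _ ⟨n, rfl⟩
      exact ⟨_, ⟨max m n, rfl⟩, hs (le_max_left _ _), hs (le_max_right _ _)⟩
    · rintro _ ⟨n, rfl⟩
      exact hs0 n
    · rwa [← Set.range_comp]
    · refine ⟨ι B, ?_⟩
      rintro _ ⟨_, ⟨_, ⟨n, rfl⟩, rfl⟩, rfl⟩
      exact hι.le_iff.2 (hB n)
    · exact directedOn_singleton _
    · simp
    · simp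
    · simp
  rw [hL1] at hf
  obtain ⟨x, hx⟩ := hf
  exact ⟨x, fun n => hι.le_iff.1 (hx ▸ hlub.1 ⟨n, rfl⟩)⟩

end UniversalCompletion

/-! ### Kronecker's lemma in order form. -/

section Convergence

variable {E : Type*} [ConditionallyCompleteLattice E] [AddCommGroup E] [IsOrderedAddMonoid E]
  [Module ℝ E] [IsOrderedModule ℝ E]

/-- Summation by parts for monotone weights. -/
lemma abs_sum_smul_le {d : ℕ → E} {α : ℕ → ℝ} (hα : Monotone α) (hα0 : ∀ i, 0 ≤ α i) {b : E}
    (hb : ∀ n, |∑ i ∈ Finset.range n, d i| ≤ b) (n : ℕ) :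
    |∑ i ∈ Finset.range (n + 1), α i • d i| ≤ (2 * α n) • b := by
  have hb0 : 0 ≤ b := (abs_nonneg _).trans (hb 0)
  -- Subtracting α n times the full sum makes each induction step cost only (α (n + 1) - α n) b, and
  -- these costs telescope.
  have key : |∑ i ∈ Finset.range (n + 1), α i • d i - α n • ∑ i ∈ Finset.range (n + 1), d i| ≤
      (α n - α 0) • b := by
    induction n with
    | zero => simp
    | succ n ih =>
      have h : ∑ i ∈ Finset.range (n + 1 + 1), α i • d i -
          α (n + 1) • ∑ i ∈ Finset.range (n + 1 + 1), d i =
          (∑ i ∈ Finset.range (n + 1), α i • d i - α n • ∑ i ∈ Finset.range (n + 1), d i) -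
            (α (n + 1) - α n) • ∑ i ∈ Finset.range (n + 1), d i := by
        rw [Finset.sum_range_succ _ (n + 1), Finset.sum_range_succ _ (n + 1), smul_add, sub_smul]
        abel
      have h2 : |(α (n + 1) - α n) • ∑ i ∈ Finset.range (n + 1), d i| ≤
          (α (n + 1) - α n) • b := by
        rw [abs_smul_of_nonneg (sub_nonneg.2 (hα n.le_succ))]
        exact smul_le_smul_of_nonneg_left (hb _) (sub_nonneg.2 (hα n.le_succ))
      rw [h, sub_eq_add_neg]
      refine (abs_add_le _ _).trans ?_
      rw [abs_neg]
      refine (add_le_add ih h2).trans (le_of_eq ?_)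
      rw [← add_smul]
      congr 1
      ring
  have h3 : |α n • ∑ i ∈ Finset.range (n + 1), d i| ≤ α n • b := by
    rw [abs_smul_of_nonneg (hα0 n)]
    exact smul_le_smul_of_nonneg_left (hb _) (hα0 n)
  calc |∑ i ∈ Finset.range (n + 1), α i • d i| =
      |(∑ i ∈ Finset.range (n + 1), α i • d i - α n • ∑ i ∈ Finset.range (n + 1), d i) +
        α n • ∑ i ∈ Finset.range (n + 1), d i| := by rw [sub_add_cancel]
    _ ≤ (α n - α 0) • b + α n • b := (abs_add_le _ _).trans (add_le_add key h3)
    _ = (2 * α n - α 0) • b := by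
      rw [← add_smul]
      congr 1
      ring
    _ ≤ (2 * α n) • b := smul_le_smul_of_nonneg_right (by linarith [hα0 0]) hb0

/-- The dominating sequence is the supremum of each tail of |x|. For a lower bound of these suprema,
n → ∞ with N fixed removes g N / a n, and the infimum over N removes b N. -/
lemma orderTendsto_zero_of_le {x g b : ℕ → E} {a : ℕ → ℝ} (ha_pos : ∀ i, 0 < a i)
    (ha_mono : Monotone a) (ha_top : Filter.Tendsto a Filter.atTop Filter.atTop)
    (hg : ∀ N, 0 ≤ g N) (hb : IsGLB (Set.range b) 0)
    (h : ∀ N n, N ≤ n → |x n| ≤ (1 / a n) • g N + (2 : ℝ) • b N) : OrderTendsto x 0 := by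
  have hle : ∀ N n, N ≤ n → ∀ m, |x (n + m)| ≤ (1 / a n) • g N + (2 : ℝ) • b N := fun N n hn m =>
    (h N (n + m) (hn.trans (Nat.le_add_right _ _))).trans (add_le_add_left
      (smul_le_smul_of_nonneg_right
        (one_div_le_one_div_of_le (ha_pos n) (ha_mono (Nat.le_add_right _ _))) (hg N)) _)
  have hlub : ∀ n, IsLUB (Set.range fun m => |x (n + m)|) (⨆ m, |x (n + m)|) := fun n =>
    isLUB_ciSup_of_le (hle n n le_rfl)
  refine ⟨fun n => ⨆ m, |x (n + m)|, fun n k hnk => (hlub k).2 ?_, ⟨?_, fun l hl => ?_⟩,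
    fun n => ?_⟩
  · rintro _ ⟨m, rfl⟩
    refine (hlub n).1 ⟨k - n + m, ?_⟩
    simp only
    congr 2
    omega
  · rintro _ ⟨n, rfl⟩
    exact (abs_nonneg _).trans ((hlub n).1 ⟨0, rfl⟩)
  · have h1 : ∀ N, l ≤ (2 : ℝ) • b N := fun N => by
      refine le_of_forall_le_add_smul (z := g N) fun ε hε => ?_
      obtain ⟨n, hn, hna⟩ := ((Filter.eventually_ge_atTop N).and
        (ha_top.eventually_ge_atTop (1 / ε))).exists
      have h2 : 1 / a n ≤ ε := (one_div_le (ha_pos n) hε).2 hna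
      refine (hl ⟨n, rfl⟩).trans ((hlub n).2 ?_)
      rintro _ ⟨m, rfl⟩
      refine (hle N n hn m).trans ?_
      rw [add_comm]
      exact add_le_add_right (smul_le_smul_of_nonneg_right h2 (hg N)) _
    have h2 : (2⁻¹ : ℝ) • l ≤ 0 := hb.2 (by
      rintro _ ⟨N, rfl⟩
      have := smul_le_smul_of_nonneg_left (h1 N) (show (0 : ℝ) ≤ 2⁻¹ by norm_num)
      rwa [smul_smul, inv_mul_cancel₀ two_ne_zero, one_smul] at this)
    have h3 := smul_le_smul_of_nonneg_left h2 (show (0 : ℝ) ≤ 2 by norm_num)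
    rwa [smul_smul, mul_inv_cancel₀ two_ne_zero, one_smul, smul_zero] at h3
  · rw [sub_zero]
    exact (hlub n).1 ⟨0, rfl⟩

end Convergence

/-! ### Truncated martingale differences in the ideal of e. -/

section MartingaleTruncation

variable {E : Type*} [ConditionallyCompleteLattice E] [AddCommGroup E] [IsOrderedAddMonoid E]
  [Module ℝ E] [IsOrderedModule ℝ E] {e : E} {T : E →ₗ[ℝ] E} {F : ℕ → E →ₗ[ℝ] E}

lemma IsConditionalExpectation.map_mem_unitIdeal (hT : IsConditionalExpectation T)
    (hTe : T e = e) (x : E) (hx : x ∈ unitIdeal e) : T x ∈ unitIdeal e := by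
  obtain ⟨c, hc⟩ := hx
  refine ⟨c, (hT.abs_map_le x).trans ?_⟩
  simpa [hTe] using hT.mono hc

lemma IsConditionalExpectation.map_truncate (hT : IsConditionalExpectation T)
    (hTe : T e = e) {y : E} (hy : T y = y) : T (truncate e y) = truncate e y := by
  refine hT.map_sup_of_fixed ?_ (by rw [map_neg, hTe])
  rw [eq_sub_of_add_eq (inf_add_sup y e), map_sub, map_add, hy, hTe, hT.map_sup_of_fixed hy hTe]

lemma IsConditionalExpectation.isUnitalCondExp_restrict (hT : IsConditionalExpectation T)
    (he : 0 ≤ e) (hTe : T e = e) :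
    IsUnitalCondExp (⟨e, self_mem_unitIdeal he⟩ : unitIdeal e)
      (T.restrict (hT.map_mem_unitIdeal hTe)) where
  positive x hx := hT.positive (x : E) hx
  unit := Subtype.ext hTe
  projection x := Subtype.ext (hT.projection (x : E))
  sup_fixed _ _ hx hy :=
    Subtype.ext (hT.map_sup_of_fixed (congrArg Subtype.val hx) (congrArg Subtype.val hy))

/-- The differences of the truncated process, recentred to form a martingale. -/
def centeredTruncation (e : E) (F : ℕ → E →ₗ[ℝ] E) (y : ℕ → E) (i : ℕ) : E :=
  truncate e (y i) - F i (truncate e (y i))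

/-- The maximal inequality for the recentred truncations. -/
theorem map_runningMax_le (he : 0 ≤ e) (hT : IsConditionalExpectation T) (hTe : T e = e)
    (hF : IsFiltration F) (hTF : IsCompatible T F) {p : ℝ} (hp1 : 1 ≤ p) (hp2 : p ≤ 2)
    {y q : ℕ → E} (hy : ∀ i, F (i + 1) (y i) = y i) (hq : ∀ i, DominatesRpow e p (y i) (q i))
    (N n : ℕ) {c : ℝ} (hc : 0 < c) :
    T (runningMax (fun i => centeredTruncation e F y (N + i)) n) ≤
      (c / 2) • e + (8 / c) • ∑ i ∈ Finset.range n, T (q (N + i)) := by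
  have hFe : ∀ i, F i e = e := fun i => by
    conv_lhs => rw [← hTe]
    conv_rhs => rw [← hTe]
    exact congrArg (fun G : E →ₗ[ℝ] E => G e) (hTF i).2
  have hTcomp : ∀ i x, T (F i x) = T x := fun i x =>
    congrArg (fun G : E →ₗ[ℝ] E => G x) (hTF i).1
  have hmap : ∀ i, ∀ x ∈ unitIdeal e, F i x ∈ unitIdeal e := fun i =>
    (hF.condExp i).map_mem_unitIdeal (hFe i)
  let e' : unitIdeal e := ⟨e, self_mem_unitIdeal he⟩
  let T' : unitIdeal e →ₗ[ℝ] unitIdeal e := T.restrict (hT.map_mem_unitIdeal hTe)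
  let G : ℕ → unitIdeal e →ₗ[ℝ] unitIdeal e := fun i => (F i).restrict (hmap i)
  have hG : ∀ i, IsUnitalCondExp e' (G i) := fun i =>
    (hF.condExp i).isUnitalCondExp_restrict he (hFe i)
  let u : ℕ → unitIdeal e := fun i => ⟨truncate e (y i),
    1, (abs_truncate_le he _).trans (inf_le_right.trans (one_smul ℝ e).ge)⟩
  let r : ℕ → unitIdeal e := fun i => ⟨q i ⊓ e,
    mem_unitIdeal_of_nonneg (c := 1) (le_inf ((hq i).nonneg he) he)
      (inf_le_right.trans (one_smul ℝ e).ge)⟩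
  let X : ℕ → unitIdeal e := fun i => u i - G i (u i)
  have hfix : ∀ i x, F i x = x → F (i + 1) x = x := fun i x hx => by
    have := congrArg (fun H : E →ₗ[ℝ] E => H x) (hF.comp_of_lt i (i + 1) i.lt_succ_self).2
    simp only [LinearMap.comp_apply, hx] at this
    exact this
  have hX : IsBoundedMartingaleDifference e' T' (fun i => G (N + i)) (fun i => X (N + i)) :=
    { condExp := fun i => hG _
      fixed_mono := fun i x hx => Subtype.ext (hfix _ _ (congrArg Subtype.val hx))
      T_positive := fun x hx => hT.positive (x : E) hx
      T_unit := Subtype.ext hTe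
      T_comp := fun i x => Subtype.ext (hTcomp _ _)
      adapted := fun i => by
        have h1 : G (N + i + 1) (u (N + i)) = u (N + i) :=
          Subtype.ext ((hF.condExp _).map_truncate (hFe _) (hy _))
        have h2 : G (N + i + 1) (G (N + i) (u (N + i))) = G (N + i) (u (N + i)) :=
          Subtype.ext (hfix _ _ ((hF.condExp _).projection _))
        change G (N + i + 1) (X (N + i)) = X (N + i)
        rw [map_sub, h1, h2]
      condExp_eq_zero := fun i => by
        change G (N + i) (X (N + i)) = 0
        rw [map_sub, (hG _).projection, sub_self] }
  have hru : ∀ i, ∀ ω : UnitChar e', ω (u i) ^ 2 ≤ ω (r i) := fun i ω =>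
    (hq i).sq_truncate_le he hp1 hp2 rfl rfl ω
  -- (u - Gu)² ≤ 2u² + 2(Gu)², followed by Jensen for the second square.
  have hw : ∀ i, ∀ ω : UnitChar e',
      ω (X (N + i)) ^ 2 ≤ ω ((2 : ℝ) • (r (N + i) + G (N + i) (r (N + i)))) := fun i ω => by
    have h1 := hru (N + i) ω
    have h2 := (hG (N + i)).sq_le (isStrongUnit_unitIdeal he) (hru (N + i)) ω
    simp only [X, map_sub, map_smul, map_add, smul_eq_mul]
    nlinarith [sq_nonneg (ω (u (N + i)) + ω (G (N + i) (u (N + i))))]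
  have hmain : T (runningMax (fun i => centeredTruncation e F y (N + i)) n) ≤ (c / 2) • e +
      (2 / c) • ∑ i ∈ Finset.range n, T ((2 : ℝ) • (q (N + i) ⊓ e + F (N + i) (q (N + i) ⊓ e))) := by
    have h1 := hX.T_runningMax_le (isStrongUnit_unitIdeal he) (hasSups_unitIdeal e) hw n hc
    have h2 : ((T' (runningMax (fun i => X (N + i)) n) : unitIdeal e) : E) ≤
      (((c / 2) • e' + (2 / c) • ∑ i ∈ Finset.range n,
        T' ((2 : ℝ) • (r (N + i) + G (N + i) (r (N + i)))) : unitIdeal e) : E) := h1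
    rw [LinearMap.coe_restrict_apply, coe_runningMax, Submodule.coe_add, Submodule.coe_smul,
      Submodule.coe_smul, AddSubmonoidClass.coe_finsetSum] at h2
    exact h2
  refine hmain.trans (add_le_add_right ?_ _)
  -- The factor 4 comes from T(2 (r + G r)) = 4 T r.
  have h8 : 8 / c = 2 / c * 4 := by ring
  rw [h8, mul_smul]
  refine smul_le_smul_of_nonneg_left ?_ (by positivity)
  rw [Finset.smul_sum]
  refine Finset.sum_le_sum fun i _ => ?_
  rw [map_smul, map_add, hTcomp, ← two_smul ℝ, smul_smul]
  norm_num only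
  exact smul_le_smul_of_nonneg_left (hT.mono inf_le_left) (by norm_num)

end MartingaleTruncation

/-! ### Order Cauchy partial sums. -/

section MartingaleConvergence

variable {E U : Type*} [ConditionallyCompleteLattice E] [AddCommGroup E] [IsOrderedAddMonoid E]
  [Module ℝ E] [IsOrderedModule ℝ E]
  [ConditionallyCompleteLattice U] [AddCommGroup U] [IsOrderedAddMonoid U]
  [Module ℝ U] [IsOrderedModule ℝ U] {ι : E →ₗ[ℝ] U}
  {e : E} {T : E →ₗ[ℝ] E} {F : ℕ → E →ₗ[ℝ] E}

lemma DominatesRpow.of_isRpow (hι : IsUniversalCompletion ι) {p : ℝ} {y z : E}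
    (h : IsRpow (ι e) p |ι y| (ι z)) : DominatesRpow e p y z := by
  intro t ht n
  rw [← hι.le_iff]
  refine le_trans ?_ (h.1 ⟨t, ht, rfl⟩)
  rw [map_smul, hι.map_inf, map_smul, hι.map_sup, map_sub, map_smul, map_zero, hι.map_abs]
  refine smul_le_smul_of_nonneg_left ?_ (Real.rpow_nonneg ht p)
  exact (isLUB_ciSup_of_le (f := fun n : ℕ => ι e ⊓ ((n : ℝ) • ((|ι y| - t • ι e) ⊔ 0)))
    fun _ => inf_le_left).1 ⟨n, rfl⟩

lemma DominatesRpow.one_div_smul {p : ℝ} {y z : E} (h : DominatesRpow e p y z) {a : ℝ}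
    (ha : 0 < a) : DominatesRpow e p ((1 / a) • y) ((1 / a ^ p) • z) := by
  intro t ht n
  -- The substitution t ↦ a t turns the multiplier n into n / a, which is rounded up to an integer.
  obtain ⟨m, hm⟩ := exists_nat_ge ((n : ℝ) * (1 / a))
  have h1 := h (a * t) (mul_nonneg ha.le ht) m
  have hap : 0 < a ^ p := Real.rpow_pos_of_pos ha p
  have h2 : (|(1 / a) • y| - t • e) ⊔ 0 = (1 / a) • ((|y| - (a * t) • e) ⊔ 0) := by
    rw [smul_sup_of_nonneg (by positivity), smul_zero, smul_sub, smul_smul,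
      abs_smul_of_nonneg (by positivity), ← mul_assoc, one_div_mul_cancel ha.ne', one_mul]
  rw [h2, smul_smul]
  calc t ^ p • (e ⊓ ((n : ℝ) * (1 / a)) • ((|y| - (a * t) • e) ⊔ 0))
      ≤ t ^ p • (e ⊓ (m : ℝ) • ((|y| - (a * t) • e) ⊔ 0)) :=
        smul_le_smul_of_nonneg_left (inf_le_inf_left _
          (smul_le_smul_of_nonneg_right hm le_sup_right)) (Real.rpow_nonneg ht p)
    _ = (1 / a ^ p) • ((a * t) ^ p • (e ⊓ (m : ℝ) • ((|y| - (a * t) • e) ⊔ 0))) := by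
        rw [smul_smul, Real.mul_rpow ha.le ht, ← mul_assoc, one_div_mul_cancel hap.ne', one_mul]
    _ ≤ (1 / a ^ p) • z := smul_le_smul_of_nonneg_left h1 (by positivity)

/-- A martingale difference sequence `y` whose `p`-th powers have `T`-bounded partial sums has
order Cauchy partial sums. -/
theorem exists_tail_bound (hι : IsUniversalCompletion ι) (he : IsWeakOrderUnit e)
    (hT : IsConditionalExpectation T) (hpos : IsStrictlyPositive T) (hTe : T e = e)
    (hL1 : naturalDomain ι T = Set.range ι) (hF : IsFiltration F) (hTF : IsCompatible T F)
    {p : ℝ} (hp1 : 1 ≤ p) (hp2 : p ≤ 2) {y q : ℕ → E} (hy : ∀ i, F (i + 1) (y i) = y i)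
    (hy0 : ∀ i, F i (y i) = 0) (hq : ∀ i, DominatesRpow e p (y i) (q i)) {B : E}
    (hB : ∀ n, T (∑ i ∈ Finset.range n, q i) ≤ B) :
    ∃ b : ℕ → E, IsGLB (Set.range b) 0 ∧
      ∀ N n, |∑ i ∈ Finset.range n, y (N + i)| ≤ b N := by
  have hTcomp : ∀ i x, T (F i x) = T x := fun i x =>
    congrArg (fun G : E →ₗ[ℝ] E => G x) (hTF i).1
  have hq0 : ∀ i, 0 ≤ q i := fun i => (hq i).nonneg he.1
  -- The term F i (q i) pays for the recentring of the truncation.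
  set w : ℕ → E := fun i => q i + F i (q i) with hwdef
  have hqw : ∀ i, q i ≤ w i := fun i =>
    le_add_of_nonneg_right ((hF.condExp i).positive _ (hq0 i))
  have hw0 : ∀ i, 0 ≤ w i := fun i => (hq0 i).trans (hqw i)
  set W : ℕ → E := fun n => ∑ i ∈ Finset.range n, w i with hWdef
  have hWmono : Monotone W := monotone_nat_of_le_succ fun n => by
    simp only [hWdef, Finset.sum_range_succ]
    exact le_add_of_nonneg_right (hw0 n)
  have hTW : ∀ n, T (W n) ≤ (2 : ℝ) • B := fun n => by
    have : T (W n) = (2 : ℝ) • T (∑ i ∈ Finset.range n, q i) := by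
      simp only [hWdef, hwdef, map_sum, map_add, hTcomp, ← two_smul ℝ, Finset.smul_sum]
    rw [this]
    exact smul_le_smul_of_nonneg_left (hB n) zero_le_two
  obtain ⟨b₀, hb₀⟩ := exists_bound_of_map_le hι he hT hpos hL1 hWmono
    (fun n => Finset.sum_nonneg fun i _ => hw0 i) hTW
  have hL := isLUB_ciSup_of_le hb₀
  set L := ⨆ n, W n
  have hWL : ∀ n, W n ≤ L := fun n => hL.1 ⟨n, rfl⟩
  have htail_anti : Antitone fun N => L - W N := fun m n h => sub_le_sub_left (hWmono h) _
  have htail : IsGLB (Set.range fun N => L - W N) 0 := by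
    refine ⟨by rintro _ ⟨n, rfl⟩; exact sub_nonneg.2 (hWL n), fun g hg => ?_⟩
    have : L ≤ L - g := hL.2 (by
      rintro _ ⟨n, rfl⟩
      exact le_sub_comm.1 (hg ⟨n, rfl⟩))
    simpa using this
  have hsumw : ∀ N n, ∑ i ∈ Finset.range n, w (N + i) ≤ L - W N := fun N n => by
    rw [le_sub_iff_add_le, add_comm]
    refine le_trans (le_of_eq ?_) (hWL (N + n))
    exact (Finset.sum_range_add _ N n).symm
  set X := centeredTruncation e F y with hXdef
  have hmax : ∀ N n, ∀ c : ℝ, 0 < c → T (runningMax (fun i => X (N + i)) n) ≤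
      (c / 2) • e + (8 / c) • T (L - W N) := fun N n c hc => by
    refine (map_runningMax_le he.1 hT hTe hF hTF hp1 hp2 hy hq N n hc).trans
      (add_le_add_right (smul_le_smul_of_nonneg_left ?_ (by positivity)) _)
    rw [← map_sum]
    exact hT.mono ((Finset.sum_le_sum fun i _ => hqw (N + i)).trans (hsumw N n))
  have hbound : ∀ N, ∃ d, ∀ n, runningMax (fun i => X (N + i)) n ≤ d := fun N =>
    exists_bound_of_map_le hι he hT hpos hL1 (runningMax_mono _) (runningMax_nonneg _)
      fun n => hmax N n 1 one_pos
  have hR : ∀ N, IsLUB (Set.range fun n => runningMax (fun i => X (N + i)) n)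
      (⨆ n, runningMax (fun i => X (N + i)) n) := fun N =>
    (hbound N).elim fun d hd => isLUB_ciSup_of_le hd
  set R : ℕ → E := fun N => ⨆ n, runningMax (fun i => X (N + i)) n
  have hTR : ∀ N, ∀ c : ℝ, 0 < c → T (R N) ≤ (c / 2) • e + (8 / c) • T (L - W N) :=
    fun N c hc => (hT.isLUB_image (runningMax_mono _) (hR N)).2 (by
      rintro _ ⟨n, rfl⟩
      exact hmax N n c hc)
  have hR0 : ∀ N, 0 ≤ R N := fun N => (runningMax_nonneg _ 0).trans ((hR N).1 ⟨0, rfl⟩)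
  have hb0 : ∀ N, 0 ≤ R N + (L - W N) := fun N => add_nonneg (hR0 N) (sub_nonneg.2 (hWL N))
  refine ⟨fun N => R N + (L - W N), ⟨by rintro _ ⟨N, rfl⟩; exact hb0 N, fun g hg => ?_⟩,
    fun N n => ?_⟩
  · refine hpos.nonpos hT (nonpos_of_forall_le_smul (y := e) fun ε hε => ?_)
    -- Taking c = 2 ε makes the first Doob term ε e; k collects the coefficients of T (L - W N) from
    -- the Doob term and from the excess.
    set k : ℝ := 8 / (2 * ε) + 1 with hk
    have hk0 : 0 < k := by positivity
    have h1 : ∀ N, T (g ⊔ 0) - ε • e ≤ k • T (L - W N) := fun N => by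
      have h2 := hT.mono (sup_le (hg ⟨N, rfl⟩) (hb0 N))
      rw [map_add] at h2
      have h3 := h2.trans (add_le_add_left (hTR N (2 * ε) (by positivity)) _)
      rw [mul_div_cancel_left₀ ε two_ne_zero, add_assoc] at h3
      rw [sub_le_iff_le_add', hk, add_smul, one_smul]
      exact h3
    have h2 : k⁻¹ • (T (g ⊔ 0) - ε • e) ≤ 0 := (hT.isGLB_image htail_anti htail).2 (by
      rintro _ ⟨N, rfl⟩
      have := smul_le_smul_of_nonneg_left (h1 N) (inv_nonneg.2 hk0.le)
      rwa [smul_smul, inv_mul_cancel₀ hk0.ne', one_smul] at this)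
    have h3 := smul_le_smul_of_nonneg_left h2 hk0.le
    rw [smul_smul, mul_inv_cancel₀ hk0.ne', one_smul, smul_zero] at h3
    exact sub_nonpos.1 h3
  · have hV : ∀ i, |y i - X i| ≤ w i := fun i => by
      -- Since F i kills y i, the difference is the excess over the truncation minus its own
      -- conditional expectation.
      have h1 : y i - X i = (y i - truncate e (y i)) + -F i (y i - truncate e (y i)) := by
        rw [hXdef, centeredTruncation, map_sub, hy0]
        abel
      have h2 := (hq i).abs_sub_truncate_le he hp1
      rw [h1]
      refine (abs_add_le _ _).trans (add_le_add h2 ?_)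
      rw [abs_neg]
      exact ((hF.condExp i).abs_map_le _).trans ((hF.condExp i).mono h2)
    have h1 : ∑ i ∈ Finset.range n, y (N + i) = ∑ i ∈ Finset.range n, X (N + i) +
        ∑ i ∈ Finset.range n, (y (N + i) - X (N + i)) := by
      rw [← Finset.sum_add_distrib]
      exact Finset.sum_congr rfl fun i _ => by abel
    rw [h1]
    refine (abs_add_le _ _).trans (add_le_add ?_ ?_)
    · exact (abs_sum_le_runningMax (fun i => X (N + i)) n).trans ((hR N).1 ⟨n, rfl⟩)
    · exact ((abs_sum_le _ _).trans (Finset.sum_le_sum fun i _ => hV (N + i))).trans (hsumw N n)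

end MartingaleConvergence

end RieszSpace

/-- Chow's strong law of large numbers in Riesz spaces. The space `E` is `L¹(T)`, `U` is its
universal completion, `e` is the chosen weak order unit; the index `0` is the first index. -/
theorem theorem6p1 {E U : Type*}
    [ConditionallyCompleteLattice E] [AddCommGroup E] [IsOrderedAddMonoid E]
    [Module ℝ E] [IsOrderedModule ℝ E]
    [ConditionallyCompleteLattice U] [AddCommGroup U] [IsOrderedAddMonoid U]
    [Module ℝ U] [IsOrderedModule ℝ U]
    (ι : E →ₗ[ℝ] U) (hι : RieszSpace.IsUniversalCompletion ι)
    (e : E) (he : RieszSpace.IsWeakOrderUnit e)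
    (T : E →ₗ[ℝ] E) (hT : RieszSpace.IsConditionalExpectation T)
    (hTpos : RieszSpace.IsStrictlyPositive T) (hTe : T e = e)
    (hL1 : RieszSpace.naturalDomain ι T = Set.range ι)
    (p : ℝ) (hp1 : 1 ≤ p) (hp2 : p ≤ 2)
    (Y : ℕ → E) (F : ℕ → E →ₗ[ℝ] E)
    (hY : RieszSpace.IsMartingaleDifference Y F)
    (hF : RieszSpace.IsCompatible T F)
    (hYp : ∀ i, RieszSpace.MemLp ι e p (Y i))
    (a : ℕ → ℝ) (ha_pos : ∀ i, 0 < a i) (ha_mono : Monotone a)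
    (ha_top : Filter.Tendsto a Filter.atTop Filter.atTop)
    (hsum : RieszSpace.OrderSummable
      (fun i => F 0 ((1 / a i ^ p) • (hYp i).absRpow))) :
    RieszSpace.OrderTendsto
      (fun n => (1 / a n) • ∑ i ∈ Finset.range (n + 1), Y i) 0 := by
  have hdom : ∀ i, RieszSpace.DominatesRpow e p ((1 / a i) • Y i)
      ((1 / a i ^ p) • (hYp i).absRpow) := fun i =>
    (RieszSpace.DominatesRpow.of_isRpow hι (hYp i).choose_spec).one_div_smul (ha_pos i)
  have hTcomp : ∀ i x, T (F i x) = T x := fun i x =>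
    congrArg (fun G : E →ₗ[ℝ] E => G x) (hF i).1
  obtain ⟨s, v, hv, -, hsv⟩ := hsum
  -- The sequence is shifted by one because Y 0 has no vanishing conditional expectation; this
  -- matches the convention that y i is fixed by F (i + 1) and killed by F i.
  obtain ⟨b, hb, hyb⟩ := RieszSpace.exists_tail_bound hι he hT hTpos hTe hL1 hY.filtration hF
    hp1 hp2 (y := fun i => (1 / a (i + 1)) • Y (i + 1))
    (q := fun i => (1 / a (i + 1) ^ p) • (hYp (i + 1)).absRpow)
    (fun i => by
      rw [map_smul, (hY.filtration.condExp _).map_of_mem_range (hY.adapted _)])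
    (fun i => by rw [map_smul, hY.condExp_succ, smul_zero])
    (fun i => hdom (i + 1)) (B := T (s + v 0)) (fun n => by
      have h1 : ∑ i ∈ Finset.range (n + 1), F 0 ((1 / a i ^ p) • (hYp i).absRpow) ≤ s + v 0 :=
        sub_le_iff_le_add'.1 ((le_abs_self _).trans ((hsv (n + 1)).trans (hv (Nat.zero_le _))))
      have h2 := hT.mono h1
      rw [← map_sum, hTcomp] at h2
      refine (hT.mono ?_).trans h2
      rw [Finset.sum_range_succ']
      exact le_add_of_nonneg_right ((hdom 0).nonneg he.1))
  have hb0 : ∀ N, 0 ≤ b N := fun N => hb.1 ⟨N, rfl⟩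
  refine RieszSpace.orderTendsto_zero_of_le (g := fun N => |∑ i ∈ Finset.range (N + 1), Y i|)
    ha_pos ha_mono ha_top (fun N => abs_nonneg _) hb fun N n hNn => ?_
  obtain ⟨m, rfl⟩ := Nat.exists_eq_add_of_le hNn
  have han : 0 ≤ 1 / a (N + m) := one_div_nonneg.2 (ha_pos _).le
  have hsplit : ∑ i ∈ Finset.range (N + m + 1), Y i = ∑ i ∈ Finset.range (N + 1), Y i +
      ∑ i ∈ Finset.range m, a (N + i + 1) • ((1 / a (N + i + 1)) • Y (N + i + 1)) := by
    rw [add_right_comm, Finset.sum_range_add]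
    congr 1
    refine Finset.sum_congr rfl fun i _ => ?_
    rw [smul_smul, mul_one_div_cancel (ha_pos _).ne', one_smul, add_right_comm]
  -- Summation by parts with the increasing weights a and the tail bound b N; the empty sum is
  -- separate because `abs_sum_smul_le` has at least one term.
  have hpart : |∑ i ∈ Finset.range m, a (N + i + 1) • ((1 / a (N + i + 1)) • Y (N + i + 1))| ≤
      (2 * a (N + m)) • b N := by
    rcases m with _ | m
    · simpa using smul_nonneg (mul_nonneg zero_le_two (ha_pos N).le) (hb0 N)
    · exact RieszSpace.abs_sum_smul_le (α := fun i => a (N + i + 1))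
        (fun i j hij => ha_mono (by omega)) (fun i => (ha_pos _).le) (hyb N) m
  rw [hsplit, RieszSpace.abs_smul_of_nonneg han]
  refine (smul_le_smul_of_nonneg_left ((abs_add_le _ _).trans
    (add_le_add_right hpart _)) han).trans (le_of_eq ?_)
  rw [smul_add, smul_smul]
  congr 2
  field_simp [(ha_pos (N + m)).ne']
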